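/- Let $\pi^E\colon E\to M$ be a smooth vector bundle of finite rank over a finite-dimensional smooth manifold $M$ (without boundary), with a connection $P^E\colon TE\to E$, i.e. a smooth map that sends $T_eE$ linearly into $E_x$ for all $x\in M$, $e\in E_x$, and such that for every local trivialization of $E$ over an open set $U\subset M$, given by isomorphisms $s(x)\colon\mathbb R^n\to E_x$ ($x\in U$), and with $\widetilde s(e)=s(\pi^E(e))^{-1}(e)$, there is a smooth family of bilinear maps $\Gamma_x\colon T_xM\times E_x\to E_x$ ($x\in U$) with $P^E(\eta)=s(x)\big(\mathrm d\widetilde s_e(\eta)\big)+\Gamma_x\big(\mathrm d\pi^E_e(\eta),e\big)$ for all $x\in U$, $e\in E_x$, $\eta\in T_eE$. Let $k\ge 2$, and let $D$ and $D'$ be compact finite-dimensional smooth manifolds, possibly with boundary. The sets $\mathcal M=\mathcal C^k(D,M)$, $\mathcal M'=\mathcal C^k(D',M)$, $\mathcal E=\mathcal C^k(D,E)$ and $\mathcal E'=\mathcal C^k(D',E)$ carry their natural Banach manifold structures: for $X=M,E$, the charts of $\mathcal C^k(D,X)$ are the maps $f\mapsto\Psi\circ(\mathrm{id}_D,f)$,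 defined on the set of those $f$ whose graph lies in $U$, where $\Psi$ is a smooth fibre-preserving diffeomorphism over $D$ from an open set $U\subset D\times X$ onto an open subset of a smooth vector bundle $\xi\to D$; the values lie in the Banach space of $\mathcal C^k$ sections of $\xi$. The same applies to $D'$. The tangent bundle of $\mathcal C^k(D,X)$ is identified with $\mathcal C^k(D,TX)$, and the vector bundles $\mathcal E\to\mathcal M$ and $\mathcal E'\to\mathcal M'$ (left-composition with $\pi^E$, pointwise linear structure on the fibres) are endowed with the natural connections $P^{\mathcal E}\colon\mathcal C^k(D,TE)\to\mathcal C^k(D,E)$ and $P^{\mathcal E'}\colon\mathcal C^k(D',TE)\to\mathcal C^k(D',E)$ given by left-composition with $P^E$. If $\phi\colon D\to D'$ is a diffeomorphism of class $\mathcal C^k$, then the map $$\phi^*\colon\mathcal E'=\mathcal C^k(D',E)\longrightarrow\mathcal E=\mathcal C^k(D,E),\qquad \phi^*(F)=F\circ\phi,$$ is affine. That is, $\phi^*\colon\mathcal E'\to\mathcal E$ and $\phi^*\colon\mathcal M'\to\mathcal M$, $f\mapsto f\circ\phi$, are smooth maps of Banach manifolds; the former covers the latter and is linear on the fibres (so it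 is a smooth morphism of Banach vector bundles); and $$P^{\mathcal E}\circ\mathrm d(\phi^*)=\phi^*\circ P^{\mathcal E'}.$$ -/

import Mathlib

open Set Filter Topology Bundle Manifold
open scoped ContDiff

/-! ### The Banach space of `C^k` maps from a compact manifold to a normed space -/

section CkSpace

/-- A finite cover of a manifold by compact sets, each contained in the domain of a chart. -/
structure CompactChartCover {B H : Type*} [NormedAddCommGroup B] [NormedSpace ℝ B]
    [TopologicalSpace H] (I : ModelWithCorners ℝ B H)
    (D : Type*) [TopologicalSpace D] [ChartedSpace H D] where
  index : Finset D
  piece : D → Set D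
  isCompact_piece : ∀ x, IsCompact (piece x)
  piece_subset : ∀ x, piece x ⊆ (extChartAt I x).source
  cover : ∀ p : D, ∃ x ∈ index, p ∈ piece x

variable {B H : Type*} [NormedAddCommGroup B] [NormedSpace ℝ B] [TopologicalSpace H]
  (I : ModelWithCorners ℝ B H) (D : Type*) [TopologicalSpace D] [ChartedSpace H D]

theorem nonempty_compactChartCover [CompactSpace D] [T2Space D] :
    Nonempty (CompactChartCover I D) := by
  have h : ∀ x : D, ∃ K : Set D, K ∈ 𝓝 x ∧ K ⊆ (extChartAt I x).source ∧ IsCompact K :=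
    fun x => local_compact_nhds (extChartAt_source_mem_nhds (I := I) x)
  choose K hK hKs hKc using h
  obtain ⟨t, ht⟩ := CompactSpace.elim_nhds_subcover K hK
  refine ⟨⟨t, K, hKc, hKs, fun p => ?_⟩⟩
  have hp : p ∈ ⋃ x ∈ t, K x := by rw [ht]; trivial
  simpa using hp

/-- A chosen finite cover; the resulting `C^k` norm does not depend on it up to equivalence. -/
noncomputable def compactChartCover [CompactSpace D] [T2Space D] : CompactChartCover I D :=
  (nonempty_compactChartCover I D).some

instance instCompactSpacePiece [CompactSpace D] [T2Space D] (x : D) :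
    CompactSpace ((compactChartCover I D).piece x) :=
  isCompact_iff_compactSpace.mp ((compactChartCover I D).isCompact_piece x)

variable {I D}
variable {W : Type*} [NormedAddCommGroup W] [NormedSpace ℝ W] {k : ℕ}

theorem contDiffOn_chart_expression [IsManifold I ∞ D] (f : C^k⟮I, D; 𝓘(ℝ, W), W⟯) (x : D) :
    ContDiffOn ℝ k (f ∘ (extChartAt I x).symm) (extChartAt I x).target := by
  have : IsManifold I k D := IsManifold.of_le (n := ∞) (by exact_mod_cast le_top)
  rw [← contMDiffOn_iff_contDiffOn]
  exact f.contMDiff.comp_contMDiffOn (contMDiffOn_extChartAt_symm x)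

theorem continuousOn_chart_iteratedFDeriv [IsManifold I ∞ D] (f : C^k⟮I, D; 𝓘(ℝ, W), W⟯) (x : D)
    (j : Fin (k + 1)) :
    ContinuousOn (fun p => iteratedFDerivWithin ℝ j (f ∘ (extChartAt I x).symm)
      (extChartAt I x).target (extChartAt I x p)) (extChartAt I x).source := by
  have h := (contDiffOn_chart_expression f x).continuousOn_iteratedFDerivWithin (m := j)
    (by exact_mod_cast Nat.lt_succ_iff.mp j.2) (uniqueDiffOn_extChartAt_target x)
  exact h.comp (continuousOn_extChartAt x) (fun p hp => (extChartAt I x).map_source hp)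

/-- For a `C^k` map `f : D → W`, all the derivatives of order at most `k` of the local expressions
of `f` in the charts of the chosen finite cover, restricted to the compact sets of the cover. -/
noncomputable def ckJet [IsManifold I ∞ D] [CompactSpace D] [T2Space D] :
    C^k⟮I, D; 𝓘(ℝ, W), W⟯ →ₗ[ℝ] (x : (compactChartCover I D).index) → (j : Fin (k + 1)) →
      C((compactChartCover I D).piece x, B [×(j : ℕ)]→L[ℝ] W) where
  toFun f x j :=
    ⟨fun p => iteratedFDerivWithin ℝ j (f ∘ (extChartAt I (x : D)).symm)
        (extChartAt I (x : D)).target (extChartAt I (x : D) p),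
      ((continuousOn_chart_iteratedFDeriv f (x : D) j).mono
        ((compactChartCover I D).piece_subset x)).domRestrict⟩
  map_add' f g := by
    funext x j
    refine ContinuousMap.ext fun p => ?_
    have hm := (extChartAt I (x : D)).map_source ((compactChartCover I D).piece_subset x p.2)
    have hj : ((j : ℕ) : WithTop ℕ∞) ≤ k := by exact_mod_cast Nat.lt_succ_iff.mp j.2
    exact iteratedFDerivWithin_add_apply
      (((contDiffOn_chart_expression f (x : D)) _ hm).of_le hj)
      (((contDiffOn_chart_expression g (x : D)) _ hm).of_le hj)
      (uniqueDiffOn_extChartAt_target (x : D)) hm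
  map_smul' a f := by
    funext x j
    refine ContinuousMap.ext fun p => ?_
    have hm := (extChartAt I (x : D)).map_source ((compactChartCover I D).piece_subset x p.2)
    have hj : ((j : ℕ) : WithTop ℕ∞) ≤ k := by exact_mod_cast Nat.lt_succ_iff.mp j.2
    exact iteratedFDerivWithin_const_smul_apply
      (((contDiffOn_chart_expression f (x : D)) _ hm).of_le hj)
      (uniqueDiffOn_extChartAt_target (x : D)) hm

theorem ckJet_injective [IsManifold I ∞ D] [CompactSpace D] [T2Space D] :
    Function.Injective (ckJet : C^k⟮I, D; 𝓘(ℝ, W), W⟯ →ₗ[ℝ] _) := by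
  intro f g h
  ext p
  obtain ⟨x, hx, hp⟩ := (compactChartCover I D).cover p
  have hs := (compactChartCover I D).piece_subset x hp
  have h1 : iteratedFDerivWithin ℝ 0 (f ∘ (extChartAt I x).symm) (extChartAt I x).target
        (extChartAt I x p) (fun i => i.elim0) =
      iteratedFDerivWithin ℝ 0 (g ∘ (extChartAt I x).symm) (extChartAt I x).target
        (extChartAt I x p) (fun i => i.elim0) :=
    congrArg (fun u => (u ⟨x, hx⟩ 0 ⟨p, hp⟩) (fun i => i.elim0)) h
  rw [iteratedFDerivWithin_zero_apply, iteratedFDerivWithin_zero_apply, Function.comp_apply,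
    Function.comp_apply, (extChartAt I x).left_inv hs] at h1
  exact h1

variable [IsManifold I ∞ D] [CompactSpace D] [T2Space D]

/-- The `C^k` norm: the maximum of the sup norms of the derivatives of order at most `k`
of the local expressions over the chosen finite cover. -/
noncomputable instance instCkNormedAddCommGroup :
    NormedAddCommGroup C^k⟮I, D; 𝓘(ℝ, W), W⟯ :=
  NormedAddCommGroup.induced _ _ (ckJet (I := I) (D := D) (W := W) (k := k)) ckJet_injective

noncomputable instance instCkNormedSpace : NormedSpace ℝ C^k⟮I, D; 𝓘(ℝ, W), W⟯ :=
  NormedSpace.induced ℝ _ _ (ckJet (I := I) (D := D) (W := W) (k := k))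

end CkSpace

/-! ### The Banach manifold `C^k(D, X)` -/

section MappingManifold

variable {B H : Type*} [NormedAddCommGroup B] [NormedSpace ℝ B] [TopologicalSpace H]
  (I : ModelWithCorners ℝ B H) (D : Type*) [TopologicalSpace D] [ChartedSpace H D]
  {BX HX : Type*} [NormedAddCommGroup BX] [NormedSpace ℝ BX] [TopologicalSpace HX]
  (IX : ModelWithCorners ℝ BX HX) (X : Type*) [TopologicalSpace X] [ChartedSpace HX X]

/-- A smooth fibrewise diffeomorphism over `D` from an open subset of the trivial fibre bundle
`D × X` onto an open subset of a smooth vector bundle over `D` (a "vector bundle neighbourhood").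
The vector bundle is presented as the image of a smooth family of projections `proj p` of a
trivial bundle `D × ℝ^N`; over a compact manifold every vector bundle is of this form.
The map is `(p, x) ↦ (p, toFun (p, x))`, its inverse is `(p, w) ↦ (p, invFun (p, w))`. -/
structure BundleNbhd where
  rank : ℕ
  proj : D → EuclideanSpace ℝ (Fin rank) →L[ℝ] EuclideanSpace ℝ (Fin rank)
  contMDiff_proj : ContMDiff I
    𝓘(ℝ, EuclideanSpace ℝ (Fin rank) →L[ℝ] EuclideanSpace ℝ (Fin rank)) ∞ proj
  proj_proj : ∀ p w, proj p (proj p w) = proj p w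
  source : Set (D × X)
  isOpen_source : IsOpen source
  target : Set (D × EuclideanSpace ℝ (Fin rank))
  isOpen_target : IsOpen target
  toFun : D × X → EuclideanSpace ℝ (Fin rank)
  invFun : D × EuclideanSpace ℝ (Fin rank) → X
  contMDiffOn_toFun : ContMDiffOn (I.prod IX) 𝓘(ℝ, EuclideanSpace ℝ (Fin rank)) ∞ toFun source
  contMDiffOn_invFun :
    ContMDiffOn (I.prod 𝓘(ℝ, EuclideanSpace ℝ (Fin rank))) IX ∞ invFun target
  proj_toFun : ∀ p x, (p, x) ∈ source → proj p (toFun (p, x)) = toFun (p, x)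
  map_source : ∀ p x, (p, x) ∈ source → (p, toFun (p, x)) ∈ target
  map_target : ∀ p w, (p, w) ∈ target → proj p w = w → (p, invFun (p, w)) ∈ source
  left_inv : ∀ p x, (p, x) ∈ source → invFun (p, toFun (p, x)) = x
  right_inv : ∀ p w, (p, w) ∈ target → proj p w = w → toFun (p, invFun (p, w)) = w

namespace BundleNbhd

variable {I D IX X}
variable (c : BundleNbhd I D IX X) (k : ℕ)

/-- The fibre of the trivial bundle in which the vector bundle sits. -/
abbrev Fib : Type := EuclideanSpace ℝ (Fin c.rank)

/-- The space of `C^k` sections of the vector bundle, a closed subspace of `C^k(D, ℝ^N)`. -/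
def sections : Submodule ℝ C^k⟮I, D; 𝓘(ℝ, c.Fib), c.Fib⟯ where
  carrier := {v | ∀ p, c.proj p (v p) = v p}
  add_mem' := by
    intro a b ha hb p
    change c.proj p (a p + b p) = a p + b p
    rw [map_add, ha p, hb p]
  zero_mem' := by
    intro p
    change c.proj p 0 = 0
    simp
  smul_mem' := by
    intro r a ha p
    change c.proj p (r • a p) = r • a p
    rw [map_smul, ha p]

/-- The domain of the chart of `C^k(D, X)` given by `c`: the maps whose graph lies in `source`. -/
def chartSource : Set C^k⟮I, D; IX, X⟯ := {f | ∀ p, (p, f p) ∈ c.source}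

/-- The image of the chart: the sections with graph in `target`. -/
def chartTarget : Set (c.sections k) := {v | ∀ p, (p, v.1 p) ∈ c.target}

variable {k}

/-- The chart `f ↦ (p ↦ toFun (p, f p))` on its domain. -/
noncomputable def chartOn (f : C^k⟮I, D; IX, X⟯) (hf : f ∈ c.chartSource k) : c.sections k :=
  ⟨⟨fun p => c.toFun (p, f p),
    (c.contMDiffOn_toFun.of_le (by exact_mod_cast le_top)).comp_contMDiff
      (contMDiff_id.prodMk f.contMDiff) hf⟩, fun p => c.proj_toFun p (f p) (hf p)⟩

open Classical in
/-- The chart `f ↦ (p ↦ toFun (p, f p))`, extended by `0` outside its domain. -/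
noncomputable def chart (f : C^k⟮I, D; IX, X⟯) : c.sections k :=
  if hf : f ∈ c.chartSource k then c.chartOn f hf else 0

/-- The inverse `v ↦ (p ↦ invFun (p, v p))` of the chart. -/
noncomputable def chartInv (v : c.sections k) (hv : v ∈ c.chartTarget k) : C^k⟮I, D; IX, X⟯ :=
  ⟨fun p => c.invFun (p, v.1 p),
    (c.contMDiffOn_invFun.of_le (by exact_mod_cast le_top)).comp_contMDiff
      (contMDiff_id.prodMk v.1.contMDiff) hv⟩

theorem chartInv_mem (v : c.sections k) (hv : v ∈ c.chartTarget k) :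
    c.chartInv v hv ∈ c.chartSource k :=
  fun p => c.map_target p (v.1 p) (hv p) (v.2 p)

theorem chart_mem (f : C^k⟮I, D; IX, X⟯) (hf : f ∈ c.chartSource k) :
    c.chart f ∈ c.chartTarget k := by
  rw [chart, dif_pos hf]
  exact fun p => c.map_source p (f p) (hf p)

theorem chart_chartInv (v : c.sections k) (hv : v ∈ c.chartTarget k) :
    c.chart (c.chartInv v hv) = v := by
  rw [chart, dif_pos (c.chartInv_mem v hv)]
  ext p : 2
  exact c.right_inv p (v.1 p) (hv p) (v.2 p)

theorem chartInv_chart (f : C^k⟮I, D; IX, X⟯) (hf : f ∈ c.chartSource k) :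
    c.chartInv (c.chart f) (c.chart_mem f hf) = f := by
  ext p
  have h : (c.chart f).1 p = c.toFun (p, f p) := by rw [chart, dif_pos hf]; rfl
  change c.invFun (p, (c.chart f).1 p) = f p
  rw [h]
  exact c.left_inv p (f p) (hf p)

section Tangent

theorem mfderiv_fibre (p : D) (x : X) (hx : (p, x) ∈ c.source) (v : TangentSpace IX x) :
    (mfderiv IX 𝓘(ℝ, c.Fib) (fun y => c.toFun (p, y)) x v : c.Fib) =
      mfderiv (I.prod IX) 𝓘(ℝ, c.Fib) c.toFun (p, x)
        ((0, v) : TangentSpace I p × TangentSpace IX x) := by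
  have h : MDifferentiableAt (I.prod IX) 𝓘(ℝ, c.Fib) c.toFun (p, x) :=
    ((c.contMDiffOn_toFun _ hx).contMDiffAt (c.isOpen_source.mem_nhds hx)).mdifferentiableAt
      (by simp)
  have h2 : MDifferentiableAt IX (I.prod IX) (fun y : X => (p, y)) x :=
    mdifferentiableAt_const.prodMk mdifferentiableAt_id
  have h3 := mfderiv_comp_apply (I' := I.prod IX) x h h2 v
  rw [mfderiv_prod_right] at h3
  exact h3

theorem proj_fibreDeriv (p : D) (x : X) (hx : (p, x) ∈ c.source) (v : TangentSpace IX x) :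
    c.proj p (mfderiv IX 𝓘(ℝ, c.Fib) (fun y => c.toFun (p, y)) x v : c.Fib) =
      (mfderiv IX 𝓘(ℝ, c.Fib) (fun y => c.toFun (p, y)) x v : c.Fib) := by
  have hx' : ContMDiffAt (I.prod IX) 𝓘(ℝ, c.Fib) ∞ c.toFun (p, x) :=
    (c.contMDiffOn_toFun _ hx).contMDiffAt (c.isOpen_source.mem_nhds hx)
  have h : MDifferentiableAt IX 𝓘(ℝ, c.Fib) (fun y => c.toFun (p, y)) x :=
    (hx'.comp x (contMDiffAt_const.prodMk contMDiffAt_id)).mdifferentiableAt (by simp)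
  have he : (c.proj p ∘ fun y => c.toFun (p, y)) =ᶠ[𝓝 x] fun y => c.toFun (p, y) := by
    have hc : ContinuousAt (fun y : X => (p, y)) x := by fun_prop
    filter_upwards [hc (c.isOpen_source.mem_nhds hx)] with y hy using c.proj_toFun p y hy
  have h1 := mfderiv_comp_apply (I' := 𝓘(ℝ, c.Fib)) (g := c.proj p) x
    (c.proj p).mdifferentiableAt h v
  rw [he.mfderiv_eq, ContinuousLinearMap.mfderiv_eq] at h1
  exact h1.symm

variable [IsManifold I ∞ D] [IsManifold IX ∞ X]

theorem contMDiff_fibreDeriv (η : C^k⟮I, D; IX.tangent, TangentBundle IX X⟯)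
    (hη : ∀ p, (p, (η p).proj) ∈ c.source) :
    ContMDiff I 𝓘(ℝ, c.Fib) k (fun p =>
      (mfderiv IX 𝓘(ℝ, c.Fib) (fun x => c.toFun (p, x)) (η p).proj (η p).snd : c.Fib)) := by
  have : IsManifold I 1 D := IsManifold.of_le (n := ∞) (by simp)
  have : IsManifold IX 1 X := IsManifold.of_le (n := ∞) (by simp)
  have : IsManifold I (k + 1) D := IsManifold.of_le (n := ∞) (by exact_mod_cast le_top)
  have : IsManifold IX (k + 1) X := IsManifold.of_le (n := ∞) (by exact_mod_cast le_top)
  have h0 : ContMDiff I (I.prod IX).tangent k (fun p : D =>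
      (equivTangentBundleProd I D IX X).symm (⟨p, 0⟩, η p)) := by
    have hz : ContMDiff I I.tangent k (fun p : D => (⟨p, 0⟩ : TangentBundle I D)) :=
      contMDiff_zeroSection ℝ (TangentSpace I : D → Type _)
    exact contMDiff_equivTangentBundleProd_symm.comp (hz.prodMk η.contMDiff)
  have h1 := (c.contMDiffOn_toFun.contMDiffOn_tangentMapWithin (m := k)
    (by exact_mod_cast le_top) c.isOpen_source.uniqueMDiffOn).comp_contMDiff h0 hη
  have h2 := (contMDiff_snd_tangentBundle_modelSpace c.Fib 𝓘(ℝ, c.Fib)).comp h1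
  refine h2.congr fun p => ?_
  rw [c.mfderiv_fibre p _ (hη p), ← mfderivWithin_of_isOpen c.isOpen_source (hη p)]
  rfl

/-- The tangent space of `C^k(D, X)` at `f` is identified with the space of `C^k` maps
`η : D → TX` with `η p ∈ T_{f p} X`. Under this identification the differential at `f` of the chart
given by `c` takes `η` to the section `p ↦ d(toFun (p, ·))_{f p} (η p)`. -/
noncomputable def chartDerivOn (η : C^k⟮I, D; IX.tangent, TangentBundle IX X⟯)
    (hη : ∀ p, (p, (η p).proj) ∈ c.source) : c.sections k :=
  ⟨⟨fun p => (mfderiv IX 𝓘(ℝ, c.Fib) (fun x => c.toFun (p, x)) (η p).proj (η p).snd : c.Fib),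
    c.contMDiff_fibreDeriv η hη⟩, fun p => c.proj_fibreDeriv p _ (hη p) _⟩

end Tangent

end BundleNbhd

end MappingManifold

/-! ### Smooth maps between manifolds of maps, and their tangent maps -/

section SmoothMaps

variable {B₁ H₁ : Type*} [NormedAddCommGroup B₁] [NormedSpace ℝ B₁] [TopologicalSpace H₁]
  {I₁ : ModelWithCorners ℝ B₁ H₁} {D₁ : Type*} [TopologicalSpace D₁] [ChartedSpace H₁ D₁]
  {BX₁ HX₁ : Type*} [NormedAddCommGroup BX₁] [NormedSpace ℝ BX₁] [TopologicalSpace HX₁]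
  {IX₁ : ModelWithCorners ℝ BX₁ HX₁} {X₁ : Type*} [TopologicalSpace X₁] [ChartedSpace HX₁ X₁]
  {B₂ H₂ : Type*} [NormedAddCommGroup B₂] [NormedSpace ℝ B₂] [TopologicalSpace H₂]
  {I₂ : ModelWithCorners ℝ B₂ H₂} {D₂ : Type*} [TopologicalSpace D₂] [ChartedSpace H₂ D₂]
  {BX₂ HX₂ : Type*} [NormedAddCommGroup BX₂] [NormedSpace ℝ BX₂] [TopologicalSpace HX₂]
  {IX₂ : ModelWithCorners ℝ BX₂ HX₂} {X₂ : Type*} [TopologicalSpace X₂] [ChartedSpace HX₂ X₂]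
  {k : ℕ}

open Classical in
/-- The local expression of `T : C^k(D₁, X₁) → C^k(D₂, X₂)` in the charts given by `c₁` and `c₂`
(extended by `0`). -/
noncomputable def localExpr (T : C^k⟮I₁, D₁; IX₁, X₁⟯ → C^k⟮I₂, D₂; IX₂, X₂⟯)
    (c₁ : BundleNbhd I₁ D₁ IX₁ X₁) (c₂ : BundleNbhd I₂ D₂ IX₂ X₂)
    (v : c₁.sections k) : c₂.sections k :=
  if hv : v ∈ c₁.chartTarget k then c₂.chart (T (c₁.chartInv v hv)) else 0

variable [IsManifold I₁ ∞ D₁] [CompactSpace D₁] [T2Space D₁]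
  [IsManifold I₂ ∞ D₂] [CompactSpace D₂] [T2Space D₂]

/-- `T : C^k(D₁, X₁) → C^k(D₂, X₂)` is a smooth map of Banach manifolds: in all charts around
`f` and around `T f`, the local expression of `T` is defined near the point representing `f`
and is smooth there. -/
def IsSmoothBetween (T : C^k⟮I₁, D₁; IX₁, X₁⟯ → C^k⟮I₂, D₂; IX₂, X₂⟯) : Prop :=
  ∀ (f : C^k⟮I₁, D₁; IX₁, X₁⟯) (c₁ : BundleNbhd I₁ D₁ IX₁ X₁) (c₂ : BundleNbhd I₂ D₂ IX₂ X₂),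
    f ∈ c₁.chartSource k → T f ∈ c₂.chartSource k →
      (∀ᶠ v in 𝓝 (c₁.chart f), ∃ hv : v ∈ c₁.chartTarget k,
        T (c₁.chartInv v hv) ∈ c₂.chartSource k) ∧
      ContDiffAt ℝ ∞ (localExpr T c₁ c₂) (c₁.chart f)

end SmoothMaps

section Composition

variable {B H : Type*} [NormedAddCommGroup B] [NormedSpace ℝ B] [TopologicalSpace H]
  {I : ModelWithCorners ℝ B H} {D : Type*} [TopologicalSpace D] [ChartedSpace H D]
  {BM HM : Type*} [NormedAddCommGroup BM] [NormedSpace ℝ BM] [TopologicalSpace HM]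
  {IM : ModelWithCorners ℝ BM HM} {M : Type*} [TopologicalSpace M] [ChartedSpace HM M]
  {F : Type*} [NormedAddCommGroup F] [NormedSpace ℝ F]
  {V : M → Type*} [TopologicalSpace (TotalSpace F V)] [∀ x, AddCommGroup (V x)]
  [∀ x, Module ℝ (V x)] [∀ x, TopologicalSpace (V x)] [FiberBundle F V]
  {k : ℕ}

/-- Left composition `C^k(D, E) → C^k(D, M)` with the projection of a vector bundle `E → M`. -/
noncomputable def projMap [VectorBundle ℝ F V] [ContMDiffVectorBundle ∞ F V IM]
    (e : C^k⟮I, D; IM.prod 𝓘(ℝ, F), TotalSpace F V⟯) : C^k⟮I, D; IM, M⟯ :=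
  ⟨fun p => (e p).proj, (contMDiff_proj V).comp e.contMDiff⟩

/-- For `e₁, e₂, e₃ ∈ C^k(D, E)`: the three lie in the same fibre of `C^k(D, E) → C^k(D, M)`, and
there `e₃ = a • e₁ + b • e₂`, the vector space structure of the fibre being the pointwise one. -/
def IsFibreCombination (a b : ℝ) (e₁ e₂ e₃ : C^k⟮I, D; IM.prod 𝓘(ℝ, F), TotalSpace F V⟯) : Prop :=
  ∃ (f : D → M) (u v : ∀ p, V (f p)),
    (∀ p, e₁ p = ⟨f p, u p⟩) ∧ (∀ p, e₂ p = ⟨f p, v p⟩) ∧ (∀ p, e₃ p = ⟨f p, a • u p + b • v p⟩)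

/-- Right composition `f ↦ f ∘ φ` with a diffeomorphism `φ : D → D'` of class `C^k`,
as a map `C^k(D', M) → C^k(D, M)`. -/
noncomputable def rightComp {B' H' : Type*} [NormedAddCommGroup B'] [NormedSpace ℝ B'] [TopologicalSpace H']
    {I' : ModelWithCorners ℝ B' H'} {D' : Type*} [TopologicalSpace D'] [ChartedSpace H' D']
    (φ : D ≃ₘ^k⟮I, I'⟯ D') (f : C^k⟮I', D'; IM, M⟯) : C^k⟮I, D; IM, M⟯ :=
  ⟨fun p => f (φ p), f.contMDiff.comp φ.contMDiff⟩

end Composition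

section TangentMap

variable {B₁ H₁ : Type*} [NormedAddCommGroup B₁] [NormedSpace ℝ B₁] [TopologicalSpace H₁]
  {I₁ : ModelWithCorners ℝ B₁ H₁} {D₁ : Type*} [TopologicalSpace D₁] [ChartedSpace H₁ D₁]
  {BX₁ HX₁ : Type*} [NormedAddCommGroup BX₁] [NormedSpace ℝ BX₁] [TopologicalSpace HX₁]
  {IX₁ : ModelWithCorners ℝ BX₁ HX₁} {X₁ : Type*} [TopologicalSpace X₁] [ChartedSpace HX₁ X₁]
  {B₂ H₂ : Type*} [NormedAddCommGroup B₂] [NormedSpace ℝ B₂] [TopologicalSpace H₂]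
  {I₂ : ModelWithCorners ℝ B₂ H₂} {D₂ : Type*} [TopologicalSpace D₂] [ChartedSpace H₂ D₂]
  {BX₂ HX₂ : Type*} [NormedAddCommGroup BX₂] [NormedSpace ℝ BX₂] [TopologicalSpace HX₂]
  {IX₂ : ModelWithCorners ℝ BX₂ HX₂} {X₂ : Type*} [TopologicalSpace X₂] [ChartedSpace HX₂ X₂]
  {k : ℕ}
  [IsManifold I₁ ∞ D₁] [CompactSpace D₁] [T2Space D₁]
  [IsManifold I₂ ∞ D₂] [CompactSpace D₂] [T2Space D₂]
  [IsManifold IX₁ ∞ X₁] [IsManifold IX₂ ∞ X₂]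

/-- With `T C^k(D, X)` identified with `C^k(D, TX)`, the map `dT` is the tangent map of
`T : C^k(D₁, X₁) → C^k(D₂, X₂)`: it covers `T`, and in all charts it is given by the Fréchet
derivative of the local expression of `T`. -/
def IsTangentMap (T : C^k⟮I₁, D₁; IX₁, X₁⟯ → C^k⟮I₂, D₂; IX₂, X₂⟯)
    (dT : C^k⟮I₁, D₁; IX₁.tangent, TangentBundle IX₁ X₁⟯ →
      C^k⟮I₂, D₂; IX₂.tangent, TangentBundle IX₂ X₂⟯) : Prop :=
  ∀ η : C^k⟮I₁, D₁; IX₁.tangent, TangentBundle IX₁ X₁⟯,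
    projMap (dT η) = T (projMap η) ∧
    ∀ (c₁ : BundleNbhd I₁ D₁ IX₁ X₁) (c₂ : BundleNbhd I₂ D₂ IX₂ X₂)
      (h₁ : ∀ p, (p, (η p).proj) ∈ c₁.source) (h₂ : ∀ p, (p, (dT η p).proj) ∈ c₂.source),
      fderiv ℝ (localExpr T c₁ c₂) (c₁.chart (projMap η)) (c₁.chartDerivOn η h₁) =
        c₂.chartDerivOn (dT η) h₂

end TangentMap

/-! ### Connections and affine maps -/

section Connections

variable {BM HM : Type*} [NormedAddCommGroup BM] [NormedSpace ℝ BM] [TopologicalSpace HM]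
  (IM : ModelWithCorners ℝ BM HM) {M : Type*} [TopologicalSpace M] [ChartedSpace HM M]
  [IsManifold IM ∞ M]
  (F : Type*) [NormedAddCommGroup F] [NormedSpace ℝ F]
  (V : M → Type*) [TopologicalSpace (TotalSpace F V)] [∀ x, AddCommGroup (V x)]
  [∀ x, Module ℝ (V x)] [∀ x, TopologicalSpace (V x)]
  [∀ x, IsTopologicalAddGroup (V x)] [∀ x, ContinuousSMul ℝ (V x)] [FiberBundle F V]
  [VectorBundle ℝ F V] [ContMDiffVectorBundle ∞ F V IM]

/-- A connection on the smooth vector bundle `π : E → M`: a smooth map `P : TE → E` which sends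
`T_e E` linearly to the fibre of `E` through `e`, and which in every local trivialization `t`
over an open set `U` has the form `P(η) = s(x) (ds̃ η) + Γ_x (dπ η, e)` for `x ∈ U`, `e ∈ E_x` and
`η ∈ T_e E`, where `s(x)` is the inverse of `t` on the fibre over `x`, `s̃` is the fibre component of
`t`, and `x ↦ Γ_x` is a smooth section over `U` of the bundle of bilinear maps
`T_x M × E_x → E_x`. -/
structure BundleConnection where
  lin : ∀ e : TotalSpace F V, TangentSpace (IM.prod 𝓘(ℝ, F)) e →ₗ[ℝ] V e.proj
  contMDiff' : ContMDiff (IM.prod 𝓘(ℝ, F)).tangent (IM.prod 𝓘(ℝ, F)) ∞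
    (fun η : TangentBundle (IM.prod 𝓘(ℝ, F)) (TotalSpace F V) =>
      (⟨η.proj.proj, lin η.proj η.snd⟩ : TotalSpace F V))
  local_form : ∀ (t : Trivialization F (π F V)) [MemTrivializationAtlas t],
    ∃ Γ : ∀ x : M, TangentSpace IM x →L[ℝ] V x →L[ℝ] V x,
      ContMDiffOn IM (IM.prod 𝓘(ℝ, BM →L[ℝ] F →L[ℝ] F)) ∞
        (fun x => (⟨x, Γ x⟩ : TotalSpace (BM →L[ℝ] F →L[ℝ] F)
          (fun x => TangentSpace IM x →L[ℝ] V x →L[ℝ] V x))) t.baseSet ∧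
      ∀ e : TotalSpace F V, e.proj ∈ t.baseSet → ∀ η : TangentSpace (IM.prod 𝓘(ℝ, F)) e,
        lin e η =
          t.symm e.proj (mfderiv (IM.prod 𝓘(ℝ, F)) 𝓘(ℝ, F) (fun e' => (t e').2) e η) +
          Γ e.proj (mfderiv (IM.prod 𝓘(ℝ, F)) IM (π F V) e η) e.snd

variable {IM F V}

/-- The natural connection on `C^k(D, E) → C^k(D, M)`: left composition with the
connection `P : TE → E`, as a map `T C^k(D, E) = C^k(D, TE) → C^k(D, E)`. -/
noncomputable def BundleConnection.natural (P : BundleConnection IM F V)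
    {B H : Type*} [NormedAddCommGroup B] [NormedSpace ℝ B] [TopologicalSpace H]
    (I : ModelWithCorners ℝ B H) (D : Type*) [TopologicalSpace D] [ChartedSpace H D] (k : ℕ)
    (η : C^k⟮I, D; (IM.prod 𝓘(ℝ, F)).tangent,
      TangentBundle (IM.prod 𝓘(ℝ, F)) (TotalSpace F V)⟯) :
    C^k⟮I, D; IM.prod 𝓘(ℝ, F), TotalSpace F V⟯ :=
  ⟨fun p => ⟨(η p).proj.proj, P.lin (η p).proj (η p).snd⟩,
    (P.contMDiff'.of_le (by exact_mod_cast le_top)).comp η.contMDiff⟩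

end Connections

section Affine

variable {B₁ H₁ : Type*} [NormedAddCommGroup B₁] [NormedSpace ℝ B₁] [TopologicalSpace H₁]
  {I₁ : ModelWithCorners ℝ B₁ H₁} {D₁ : Type*} [TopologicalSpace D₁] [ChartedSpace H₁ D₁]
  [IsManifold I₁ ∞ D₁] [CompactSpace D₁] [T2Space D₁]
  {BM₁ HM₁ : Type*} [NormedAddCommGroup BM₁] [NormedSpace ℝ BM₁] [TopologicalSpace HM₁]
  {IM₁ : ModelWithCorners ℝ BM₁ HM₁} {M₁ : Type*} [TopologicalSpace M₁] [ChartedSpace HM₁ M₁]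
  [IsManifold IM₁ ∞ M₁]
  {F₁ : Type*} [NormedAddCommGroup F₁] [NormedSpace ℝ F₁]
  {V₁ : M₁ → Type*} [TopologicalSpace (TotalSpace F₁ V₁)] [∀ x, AddCommGroup (V₁ x)]
  [∀ x, Module ℝ (V₁ x)] [∀ x, TopologicalSpace (V₁ x)] [FiberBundle F₁ V₁]
  [VectorBundle ℝ F₁ V₁] [ContMDiffVectorBundle ∞ F₁ V₁ IM₁]
  {B₂ H₂ : Type*} [NormedAddCommGroup B₂] [NormedSpace ℝ B₂] [TopologicalSpace H₂]
  {I₂ : ModelWithCorners ℝ B₂ H₂} {D₂ : Type*} [TopologicalSpace D₂] [ChartedSpace H₂ D₂]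
  [IsManifold I₂ ∞ D₂] [CompactSpace D₂] [T2Space D₂]
  {BM₂ HM₂ : Type*} [NormedAddCommGroup BM₂] [NormedSpace ℝ BM₂] [TopologicalSpace HM₂]
  {IM₂ : ModelWithCorners ℝ BM₂ HM₂} {M₂ : Type*} [TopologicalSpace M₂] [ChartedSpace HM₂ M₂]
  [IsManifold IM₂ ∞ M₂]
  {F₂ : Type*} [NormedAddCommGroup F₂] [NormedSpace ℝ F₂]
  {V₂ : M₂ → Type*} [TopologicalSpace (TotalSpace F₂ V₂)] [∀ x, AddCommGroup (V₂ x)]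
  [∀ x, Module ℝ (V₂ x)] [∀ x, TopologicalSpace (V₂ x)] [FiberBundle F₂ V₂]
  [VectorBundle ℝ F₂ V₂] [ContMDiffVectorBundle ∞ F₂ V₂ IM₂]
  {k : ℕ}

/-- Let `C^k(D₁, E₁)` and `C^k(D₂, E₂)` be endowed with the connections `P₁` and `P₂`. The map
`T : C^k(D₁, E₁) → C^k(D₂, E₂)` is affine over `f : C^k(D₁, M₁) → C^k(D₂, M₂)`: both are smooth,
`T` covers `f` and is linear on the fibres (a smooth morphism of Banach vector bundles), and
`P₂ ∘ dT = T ∘ P₁`. -/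
structure IsAffineMap
    (P₁ : C^k⟮I₁, D₁; (IM₁.prod 𝓘(ℝ, F₁)).tangent,
      TangentBundle (IM₁.prod 𝓘(ℝ, F₁)) (TotalSpace F₁ V₁)⟯ →
        C^k⟮I₁, D₁; IM₁.prod 𝓘(ℝ, F₁), TotalSpace F₁ V₁⟯)
    (P₂ : C^k⟮I₂, D₂; (IM₂.prod 𝓘(ℝ, F₂)).tangent,
      TangentBundle (IM₂.prod 𝓘(ℝ, F₂)) (TotalSpace F₂ V₂)⟯ →
        C^k⟮I₂, D₂; IM₂.prod 𝓘(ℝ, F₂), TotalSpace F₂ V₂⟯)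
    (T : C^k⟮I₁, D₁; IM₁.prod 𝓘(ℝ, F₁), TotalSpace F₁ V₁⟯ →
      C^k⟮I₂, D₂; IM₂.prod 𝓘(ℝ, F₂), TotalSpace F₂ V₂⟯)
    (f : C^k⟮I₁, D₁; IM₁, M₁⟯ → C^k⟮I₂, D₂; IM₂, M₂⟯) : Prop where
  smooth_base : IsSmoothBetween f
  smooth_total : IsSmoothBetween T
  covers : ∀ e, projMap (T e) = f (projMap e)
  linear : ∀ (a b : ℝ) e₁ e₂ e₃, IsFibreCombination a b e₁ e₂ e₃ →
    IsFibreCombination a b (T e₁) (T e₂) (T e₃)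
  comm : ∃ dT, IsTangentMap T dT ∧ ∀ η, P₂ (dT η) = T (P₁ η)

end Affine

/-!
Right composition with `φ` is smooth although `φ` is only of class `C^k`, because it is linear: if
`Ψ₁` and `Ψ₂` are the fibrewise diffeomorphisms which define charts of `C^k(D', X)` and `C^k(D, X)`,
then `f ↦ f ∘ φ` becomes `v ↦ (p ↦ Ψ₂ (p, Ψ₁⁻¹ (φ p, v (φ p))))`. This is the continuous linear map
`v ↦ v ∘ φ` (`ContMDiffMap.pullbackCLM`) followed by the superposition operator
`w ↦ (p ↦ g (p, φ p, w p))`, whose kernel `g (p, q, w) = Ψ₂ (p, Ψ₁⁻¹ (q, w))` is smooth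
(`BundleNbhd.transition`).

A superposition operator with smooth kernel is smooth between spaces of `C^k` maps
(`contDiffOn_superposition`). Its derivative at `w₀` is pointwise application of the superposition
operator with kernel `∂g/∂w`, a bounded bilinear operation, so induction on the order of
differentiability reduces the claim to first order (`hasFDerivAt_superposition`): the remainder
`g(·, w) - g(·, w₀) - ∂g/∂w (·, w₀) (w - w₀)` has to be `o(‖w - w₀‖)` in the `C^k` norm, that is, in
charts and over compact sets, together with its derivatives in `p` of order at most `k`. This is the
chain rule `HasCkExpansion.comp`, proved by induction on `k`: the derivative in `p` of `G ∘ u` is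
`(z, A) ↦ DG z ∘ A` applied to `(u, Du)`, and by the symmetry of the second derivative of `G` the
derivative in `p` of the linear term `DG(u₀) (du)` is the linear term which belongs to that new
function. Since `D` and `D'` may have a boundary, derivatives are taken within sets of the form
"convex with nonempty interior, intersected with open", such as the targets of charts.

Evaluating the derivative pointwise, the chain rule in the fibres identifies the tangent map with
right composition with `φ` on `C^k(D', TX)` (`isTangentMap_rightComp`). It commutes with left
composition with the connection, and the remaining assertions hold pointwise.
-/

/-! ### Convex sets cut by open sets -/

section ConvexInterOpen

variable {Z : Type*} [NormedAddCommGroup Z] [NormedSpace ℝ Z]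

/-- A set of the form `C ∩ O` with `C` convex with nonempty interior and `O` open. The targets of
the charts of a manifold with boundary or corners are of this form. -/
def IsConvexInterOpen (Q : Set Z) : Prop :=
  ∃ C O : Set Z, Convex ℝ C ∧ (interior C).Nonempty ∧ IsOpen O ∧ Q = C ∩ O

namespace IsConvexInterOpen

variable {Q : Set Z}

theorem uniqueDiffOn (hQ : IsConvexInterOpen Q) : UniqueDiffOn ℝ Q := by
  obtain ⟨C, O, hC, hCi, hO, rfl⟩ := hQ
  exact (uniqueDiffOn_convex hC hCi).inter hO

theorem subset_closure_interior (hQ : IsConvexInterOpen Q) : Q ⊆ closure (interior Q) := by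
  obtain ⟨C, O, hC, hCi, hO, rfl⟩ := hQ
  rintro z ⟨hzC, hzO⟩
  rw [interior_inter, hO.interior_eq]
  have h1 : z ∈ closure (interior C) := by
    rw [hC.closure_interior_eq_closure_of_nonempty_interior hCi]
    exact subset_closure hzC
  rw [inter_comm]
  exact hO.inter_closure ⟨hzO, h1⟩

theorem prod_univ (hQ : IsConvexInterOpen Q) (A : Type*) [NormedAddCommGroup A]
    [NormedSpace ℝ A] : IsConvexInterOpen (Q ×ˢ (univ : Set A)) := by
  obtain ⟨C, O, hC, hCi, hO, rfl⟩ := hQ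
  refine ⟨C ×ˢ univ, O ×ˢ univ, hC.prod convex_univ, ?_, hO.prod isOpen_univ, ?_⟩
  · rw [interior_prod_eq, interior_univ]
    exact hCi.prod univ_nonempty
  · rw [prod_inter_prod, univ_inter]

/-- A `C^1` function on `Q` is uniformly differentiable at the points of a compact subset. -/
theorem exists_uniform_taylor {Y : Type*} [NormedAddCommGroup Y] [NormedSpace ℝ Y]
    (hQ : IsConvexInterOpen Q) {G : Z → Y} (hG : ContDiffOn ℝ 1 G Q) {L : Set Z}
    (hL : IsCompact L) (hLQ : L ⊆ Q) {ε : ℝ} (hε : 0 < ε) :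
    ∃ δ > 0, ∀ z₀ ∈ L, ∀ z ∈ Q, ‖z - z₀‖ < δ →
      ‖G z - G z₀ - fderivWithin ℝ G Q z₀ (z - z₀)‖ ≤ ε * ‖z - z₀‖ := by
  have hud := hQ.uniqueDiffOn
  suffices h : ∃ δ > 0, ∀ z₀ ∈ L ∩ Q, ∀ z ∈ Q, ‖z - z₀‖ < δ →
      ‖G z - G z₀ - fderivWithin ℝ G Q z₀ (z - z₀)‖ ≤ ε * ‖z - z₀‖ by
    rwa [inter_eq_left.2 hLQ] at h
  refine hL.induction_on (p := fun L => ∃ δ > 0, ∀ z₀ ∈ L ∩ Q, ∀ z ∈ Q, ‖z - z₀‖ < δ →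
      ‖G z - G z₀ - fderivWithin ℝ G Q z₀ (z - z₀)‖ ≤ ε * ‖z - z₀‖) ⟨1, one_pos, by simp⟩ ?_ ?_ ?_
  · rintro s t hst ⟨δ, hδ, h⟩
    exact ⟨δ, hδ, fun z₀ hz₀ => h z₀ ⟨hst hz₀.1, hz₀.2⟩⟩
  · rintro s t ⟨δ, hδ, h⟩ ⟨δ', hδ', h'⟩
    refine ⟨min δ δ', lt_min hδ hδ', ?_⟩
    rintro z₀ ⟨hs | ht, hz₀⟩ z hz hzz
    · exact h z₀ ⟨hs, hz₀⟩ z hz (hzz.trans_le (min_le_left _ _))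
    · exact h' z₀ ⟨ht, hz₀⟩ z hz (hzz.trans_le (min_le_right _ _))
  · intro a ha
    have haQ := hLQ ha
    have hcont : ContinuousWithinAt (fderivWithin ℝ G Q) Q a :=
      hG.continuousOn_fderivWithin hud le_rfl a haQ
    have h1 : ∀ᶠ z in 𝓝[Q] a, ‖fderivWithin ℝ G Q z - fderivWithin ℝ G Q a‖ < ε / 2 := by
      have := Metric.tendsto_nhds.1 hcont (ε / 2) (half_pos hε)
      simpa only [dist_eq_norm] using this
    obtain ⟨C, O, hC, hCi, hO, hQe⟩ := id hQ
    have haO : a ∈ O := (hQe ▸ haQ).2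
    obtain ⟨r, hr, hr1⟩ := Metric.mem_nhdsWithin_iff.1 h1
    obtain ⟨r', hr', hr'1⟩ := Metric.isOpen_iff.1 hO a haO
    set ρ := min r r' with hρ
    have hρ0 : 0 < ρ := lt_min hr hr'
    have hconv : Convex ℝ (Q ∩ Metric.ball a ρ) := by
      have : Q ∩ Metric.ball a ρ = C ∩ Metric.ball a ρ := by
        rw [hQe, inter_assoc]
        congr 1
        exact inter_eq_right.2
          ((Metric.ball_subset_ball (min_le_right _ _)).trans hr'1)
      rw [this]
      exact hC.inter (convex_ball a ρ)
    have hb : ∀ z ∈ Q ∩ Metric.ball a ρ,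
        ‖fderivWithin ℝ G Q z - fderivWithin ℝ G Q a‖ ≤ ε / 2 := fun z hz =>
      (hr1 ⟨Metric.ball_subset_ball (min_le_left _ _) hz.2, hz.1⟩ : _ < _).le
    refine ⟨Metric.ball a (ρ / 2), mem_nhdsWithin_of_mem_nhds
      (Metric.ball_mem_nhds _ (half_pos hρ0)), ρ / 2, half_pos hρ0, ?_⟩
    rintro z₀ ⟨hz₀a, hz₀⟩ z hz hzz
    have hz₀' : z₀ ∈ Q ∩ Metric.ball a ρ :=
      ⟨hz₀, Metric.ball_subset_ball (by linarith) hz₀a⟩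
    have hz' : z ∈ Q ∩ Metric.ball a ρ := by
      refine ⟨hz, ?_⟩
      have h2 := dist_triangle z z₀ a
      rw [Metric.mem_ball] at hz₀a ⊢
      rw [← dist_eq_norm] at hzz
      linarith
    have h3 := hconv.norm_image_sub_le_of_norm_hasFDerivWithin_le'
      (f := G) (f' := fderivWithin ℝ G Q) (φ := fderivWithin ℝ G Q a)
      (fun x hx => (((hG.differentiableOn one_ne_zero) x hx.1).hasFDerivWithinAt).mono
        inter_subset_left) hb hz₀' hz'
    have h4 : ‖(fderivWithin ℝ G Q z₀ - fderivWithin ℝ G Q a) (z - z₀)‖ ≤ ε / 2 * ‖z - z₀‖ :=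
      ContinuousLinearMap.le_of_opNorm_le _ (hb z₀ hz₀') _
    calc ‖G z - G z₀ - fderivWithin ℝ G Q z₀ (z - z₀)‖
        = ‖(G z - G z₀ - fderivWithin ℝ G Q a (z - z₀)) -
            (fderivWithin ℝ G Q z₀ - fderivWithin ℝ G Q a) (z - z₀)‖ := by
          congr 1
          simp
      _ ≤ ε / 2 * ‖z - z₀‖ + ε / 2 * ‖z - z₀‖ := (norm_sub_le _ _).trans (add_le_add h3 h4)
      _ = ε * ‖z - z₀‖ := by ring

end IsConvexInterOpen

end ConvexInterOpen

/-! ### Expansions of families of maps in the `C^k` sense -/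

section Expansion

open Asymptotics

variable {ι : Type*} {B : Type*} [NormedAddCommGroup B] [NormedSpace ℝ B]
  {Z : Type*} [NormedAddCommGroup Z] [NormedSpace ℝ Z]
  {Y : Type*} [NormedAddCommGroup Y] [NormedSpace ℝ Y]

/-- `r i = O(b i)` along `l`, in the `C^k` sense on `K`: all derivatives within `S` of order at most
`k` are `O(b i)`, uniformly over the points of `K`. -/
def CkIsBigO (k : ℕ) (S K : Set B) (l : Filter ι) (r : ι → B → Z) (b : ι → ℝ) : Prop :=
  ∀ j ≤ k, (fun x : ι × B => iteratedFDerivWithin ℝ j (r x.1) S x.2) =O[l ×ˢ 𝓟 K] fun x => b x.1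

/-- `r i = o(b i)` along `l`, in the `C^k` sense on `K`: all derivatives within `S` of order at most
`k` are `o(b i)`, uniformly over the points of `K`. -/
def CkIsLittleO (k : ℕ) (S K : Set B) (l : Filter ι) (r : ι → B → Z) (b : ι → ℝ) : Prop :=
  ∀ j ≤ k, (fun x : ι × B => iteratedFDerivWithin ℝ j (r x.1) S x.2) =o[l ×ˢ 𝓟 K] fun x => b x.1

variable {k : ℕ} {S K : Set B} {l : Filter ι} {r r' : ι → B → Z} {b : ι → ℝ}

theorem CkIsBigO.congr (h : CkIsBigO k S K l r b) (hKS : K ⊆ S)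
    (hr : ∀ᶠ i in l, EqOn (r i) (r' i) S) : CkIsBigO k S K l r' b := fun j hj =>
  (h j hj).congr' (eventually_prod_principal_iff.2 (hr.mono fun _ hi _ hx =>
    iteratedFDerivWithin_congr hi (hKS hx) j)) EventuallyEq.rfl

theorem CkIsLittleO.congr (h : CkIsLittleO k S K l r b) (hKS : K ⊆ S)
    (hr : ∀ᶠ i in l, EqOn (r i) (r' i) S) : CkIsLittleO k S K l r' b := fun j hj =>
  (h j hj).congr' (eventually_prod_principal_iff.2 (hr.mono fun _ hi _ hx =>
    iteratedFDerivWithin_congr hi (hKS hx) j)) EventuallyEq.rfl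

theorem norm_iteratedFDerivWithin_fderivWithin_eventuallyEq (hS : UniqueDiffOn ℝ S) (hKS : K ⊆ S)
    (j : ℕ) :
    (fun x : ι × B => ‖iteratedFDerivWithin ℝ j (fderivWithin ℝ (r x.1) S) S x.2‖)
      =ᶠ[l ×ˢ 𝓟 K] fun x => ‖iteratedFDerivWithin ℝ (j + 1) (r x.1) S x.2‖ :=
  eventually_prod_principal_iff.2 (Eventually.of_forall fun _ _ hx =>
    norm_iteratedFDerivWithin_fderivWithin hS (hKS hx))

theorem ckIsBigO_zero :
    CkIsBigO 0 S K l r b ↔ (fun x : ι × B => r x.1 x.2) =O[l ×ˢ 𝓟 K] fun x => b x.1 := by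
  have h : (fun x : ι × B => ‖iteratedFDerivWithin ℝ 0 (r x.1) S x.2‖) = fun x => ‖r x.1 x.2‖ := by
    funext x
    exact norm_iteratedFDerivWithin_zero
  simp only [CkIsBigO, Nat.le_zero, forall_eq]
  rw [← isBigO_norm_left, h, isBigO_norm_left]

theorem ckIsLittleO_zero :
    CkIsLittleO 0 S K l r b ↔ (fun x : ι × B => r x.1 x.2) =o[l ×ˢ 𝓟 K] fun x => b x.1 := by
  have h : (fun x : ι × B => ‖iteratedFDerivWithin ℝ 0 (r x.1) S x.2‖) = fun x => ‖r x.1 x.2‖ := by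
    funext x
    exact norm_iteratedFDerivWithin_zero
  simp only [CkIsLittleO, Nat.le_zero, forall_eq]
  rw [← isLittleO_norm_left, h, isLittleO_norm_left]

theorem ckIsBigO_succ (hS : UniqueDiffOn ℝ S) (hKS : K ⊆ S) :
    CkIsBigO (k + 1) S K l r b ↔
      CkIsBigO 0 S K l r b ∧ CkIsBigO k S K l (fun i => fderivWithin ℝ (r i) S) b := by
  have key : ∀ j, (fun x : ι × B => iteratedFDerivWithin ℝ j (fderivWithin ℝ (r x.1) S) S x.2)
      =O[l ×ˢ 𝓟 K] (fun x => b x.1) ↔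
      (fun x : ι × B => iteratedFDerivWithin ℝ (j + 1) (r x.1) S x.2)
        =O[l ×ˢ 𝓟 K] fun x => b x.1 := fun j => by
    rw [← isBigO_norm_left, ← isBigO_norm_left (f' := fun x : ι × B =>
      iteratedFDerivWithin ℝ (j + 1) (r x.1) S x.2)]
    exact isBigO_congr (norm_iteratedFDerivWithin_fderivWithin_eventuallyEq hS hKS j)
      EventuallyEq.rfl
  refine ⟨fun h => ⟨fun j hj => h j (by omega), fun j hj => (key j).2 (h (j + 1) (by omega))⟩,
    fun h j hj => ?_⟩
  rcases j with _ | j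
  · exact h.1 0 le_rfl
  · exact (key j).1 (h.2 j (by omega))

theorem ckIsLittleO_succ (hS : UniqueDiffOn ℝ S) (hKS : K ⊆ S) :
    CkIsLittleO (k + 1) S K l r b ↔
      CkIsLittleO 0 S K l r b ∧ CkIsLittleO k S K l (fun i => fderivWithin ℝ (r i) S) b := by
  have key : ∀ j, (fun x : ι × B => iteratedFDerivWithin ℝ j (fderivWithin ℝ (r x.1) S) S x.2)
      =o[l ×ˢ 𝓟 K] (fun x => b x.1) ↔
      (fun x : ι × B => iteratedFDerivWithin ℝ (j + 1) (r x.1) S x.2)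
        =o[l ×ˢ 𝓟 K] fun x => b x.1 := fun j => by
    rw [← isLittleO_norm_left, ← isLittleO_norm_left (f' := fun x : ι × B =>
      iteratedFDerivWithin ℝ (j + 1) (r x.1) S x.2)]
    exact isLittleO_congr (norm_iteratedFDerivWithin_fderivWithin_eventuallyEq hS hKS j)
      EventuallyEq.rfl
  refine ⟨fun h => ⟨fun j hj => h j (by omega), fun j hj => (key j).2 (h (j + 1) (by omega))⟩,
    fun h j hj => ?_⟩
  rcases j with _ | j
  · exact h.1 0 le_rfl
  · exact (key j).1 (h.2 j (by omega))

theorem norm_iteratedFDerivWithin_prodMk_eventually_le {r' : ι → B → Y} (hS : UniqueDiffOn ℝ S)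
    (hKS : K ⊆ S) (hr : ∀ᶠ i in l, ContDiffOn ℝ k (r i) S)
    (hr' : ∀ᶠ i in l, ContDiffOn ℝ k (r' i) S) {j : ℕ} (hj : j ≤ k) :
    ∀ᶠ x : ι × B in l ×ˢ 𝓟 K, ‖iteratedFDerivWithin ℝ j (fun p => (r x.1 p, r' x.1 p)) S x.2‖ ≤
      1 * ‖(iteratedFDerivWithin ℝ j (r x.1) S x.2, iteratedFDerivWithin ℝ j (r' x.1) S x.2)‖ :=
  eventually_prod_principal_iff.2 ((hr.and hr').mono fun i hi p hp => by
    rw [iteratedFDerivWithin_prodMk (hi.1 p (hKS hp)) (hi.2 p (hKS hp)) hS (hKS hp)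
      (by exact_mod_cast hj), one_mul, Prod.norm_def]
    exact (ContinuousMultilinearMap.opNorm_prod _ _).le)

theorem CkIsBigO.prodMk {r' : ι → B → Y} (hS : UniqueDiffOn ℝ S) (hKS : K ⊆ S)
    (hr : ∀ᶠ i in l, ContDiffOn ℝ k (r i) S) (hr' : ∀ᶠ i in l, ContDiffOn ℝ k (r' i) S)
    (h : CkIsBigO k S K l r b) (h' : CkIsBigO k S K l r' b) :
    CkIsBigO k S K l (fun i p => (r i p, r' i p)) b := fun j hj =>
  (IsBigO.of_bound 1 (norm_iteratedFDerivWithin_prodMk_eventually_le hS hKS hr hr' hj)).trans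
    ((h j hj).prod_left (h' j hj))

theorem CkIsLittleO.prodMk {r' : ι → B → Y} (hS : UniqueDiffOn ℝ S) (hKS : K ⊆ S)
    (hr : ∀ᶠ i in l, ContDiffOn ℝ k (r i) S) (hr' : ∀ᶠ i in l, ContDiffOn ℝ k (r' i) S)
    (h : CkIsLittleO k S K l r b) (h' : CkIsLittleO k S K l r' b) :
    CkIsLittleO k S K l (fun i p => (r i p, r' i p)) b := fun j hj =>
  (IsBigO.of_bound 1
    (norm_iteratedFDerivWithin_prodMk_eventually_le hS hKS hr hr' hj)).trans_isLittleO
    ((h j hj).prod_left (h' j hj))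

end Expansion

/-! ### The chain rule for expansions -/

section Expansion

open Asymptotics

universe w₁ w₂

variable {ι : Type*} {B : Type w₁} [NormedAddCommGroup B] [NormedSpace ℝ B]

/-- The `C^k` expansion `u i = u₀ + du i + o(b i)`, `du i = O(b i)`, along `l`: the estimates hold
for all derivatives within `S` of order at most `k`, uniformly over `K`. -/
structure HasCkExpansion {Z : Type*} [NormedAddCommGroup Z] [NormedSpace ℝ Z] (k : ℕ)
    (S K : Set B) (l : Filter ι) (u : ι → B → Z) (u₀ : B → Z) (du : ι → B → Z)
    (b : ι → ℝ) : Prop where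
  contDiffOn_zero : ContDiffOn ℝ k u₀ S
  contDiffOn : ∀ᶠ i in l, ContDiffOn ℝ k (u i) S
  contDiffOn_deriv : ∀ᶠ i in l, ContDiffOn ℝ k (du i) S
  isBigO : CkIsBigO k S K l du b
  isLittleO : CkIsLittleO k S K l (fun i p => u i p - u₀ p - du i p) b

/-- The derivative of `p ↦ DG (u p) (w p)` is the directional derivative of
`(z, A) ↦ DG z ∘ A`, the function expressing the derivative of `G ∘ u` through `(u, Du)`. This
rests on the symmetry of the second derivative of `G`. -/
theorem fderivWithin_fderivWithin_apply {Z Y : Type*} [NormedAddCommGroup Z] [NormedSpace ℝ Z]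
    [NormedAddCommGroup Y] [NormedSpace ℝ Y] {Q : Set Z} (hQ : IsConvexInterOpen Q) {G : Z → Y}
    (hG : ContDiffOn ℝ ∞ G Q) {S : Set B} (hS : UniqueDiffOn ℝ S) {u w : B → Z} {p : B}
    (hp : p ∈ S) (huQ : MapsTo u S Q) (hu : DifferentiableWithinAt ℝ u S p)
    (hw : DifferentiableWithinAt ℝ w S p) :
    fderivWithin ℝ (fun q => fderivWithin ℝ G Q (u q) (w q)) S p =
      fderivWithin ℝ (fun z : Z × (B →L[ℝ] Z) => (fderivWithin ℝ G Q z.1).comp z.2)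
        (Q ×ˢ univ) (u p, fderivWithin ℝ u S p) (w p, fderivWithin ℝ w S p) := by
  have hud := hQ.uniqueDiffOn
  have hG1 : ContDiffOn ℝ ∞ (fderivWithin ℝ G Q) Q :=
    hG.fderivWithin hud (by simp)
  have hG' : HasFDerivWithinAt (fderivWithin ℝ G Q)
      (fderivWithin ℝ (fderivWithin ℝ G Q) Q (u p)) Q (u p) :=
    ((hG1.differentiableOn (by simp)) (u p) (huQ hp)).hasFDerivWithinAt
  have h1 := (hG'.comp p hu.hasFDerivWithinAt huQ).clm_apply hw.hasFDerivWithinAt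
  have h2 : HasFDerivWithinAt (fun z : Z × (B →L[ℝ] Z) => fderivWithin ℝ G Q z.1)
      ((fderivWithin ℝ (fderivWithin ℝ G Q) Q (u p)).comp (ContinuousLinearMap.fst ℝ _ _))
      (Q ×ˢ univ) (u p, fderivWithin ℝ u S p) :=
    HasFDerivWithinAt.comp (t := Q) (u p, fderivWithin ℝ u S p) hG' hasFDerivWithinAt_fst
      (fun z hz => hz.1)
  have h3 := h2.clm_comp (hasFDerivWithinAt_snd (𝕜 := ℝ) (E := Z) (F := B →L[ℝ] Z)
    (s := Q ×ˢ univ) (p := (u p, fderivWithin ℝ u S p)))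
  have hsymm : IsSymmSndFDerivWithinAt ℝ G Q (u p) :=
    (hG (u p) (huQ hp)).isSymmSndFDerivWithinAt
      (by simpa using (WithTop.coe_le_coe.2 le_top : ((2 : ℕ∞) : WithTop ℕ∞) ≤ ∞)) hud
      (hQ.subset_closure_interior (huQ hp)) (huQ hp)
  have h1' := h1.fderivWithin (hS p hp)
  simp only [Function.comp_def] at h1'
  rw [h1', h3.fderivWithin ((hQ.prod_univ _).uniqueDiffOn _ ⟨huQ hp, mem_univ _⟩)]
  ext β
  have := hsymm (fderivWithin ℝ u S p β) (w p)
  simp [this, add_comm]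

theorem HasCkExpansion.of_le {Z : Type*} [NormedAddCommGroup Z] [NormedSpace ℝ Z] {k m : ℕ}
    {S K : Set B} {l : Filter ι} {u : ι → B → Z} {u₀ : B → Z} {du : ι → B → Z} {b : ι → ℝ}
    (h : HasCkExpansion k S K l u u₀ du b) (hm : m ≤ k) : HasCkExpansion m S K l u u₀ du b where
  contDiffOn_zero := h.contDiffOn_zero.of_le (by exact_mod_cast hm)
  contDiffOn := h.contDiffOn.mono fun _ hi => hi.of_le (by exact_mod_cast hm)
  contDiffOn_deriv := h.contDiffOn_deriv.mono fun _ hi => hi.of_le (by exact_mod_cast hm)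
  isBigO j hj := h.isBigO j (hj.trans hm)
  isLittleO j hj := h.isLittleO j (hj.trans hm)

/-- The case `k = 0`: it only requires `G` to be uniformly differentiable at the points of the
compact set `u₀(K)`. -/
theorem HasCkExpansion.isBigO_isLittleO_comp_zero {Z Y : Type*} [NormedAddCommGroup Z]
    [NormedSpace ℝ Z] [NormedAddCommGroup Y] [NormedSpace ℝ Y] {Q : Set Z}
    (hQ : IsConvexInterOpen Q) {G : Z → Y} (hG : ContDiffOn ℝ ∞ G Q) {S K : Set B}
    (hKS : K ⊆ S) (hK : IsCompact K) {l : Filter ι} {u : ι → B → Z} {u₀ : B → Z}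
    {du : ι → B → Z} {b : ι → ℝ} (h : HasCkExpansion 0 S K l u u₀ du b)
    (hb : Tendsto b l (𝓝 0)) (h₀ : MapsTo u₀ S Q) (hu : ∀ᶠ i in l, MapsTo (u i) S Q) :
    CkIsBigO 0 S K l (fun i p => fderivWithin ℝ G Q (u₀ p) (du i p)) b ∧
    CkIsLittleO 0 S K l
      (fun i p => G (u i p) - G (u₀ p) - fderivWithin ℝ G Q (u₀ p) (du i p)) b := by
  have hud := hQ.uniqueDiffOn
  have hO := ckIsBigO_zero.1 h.isBigO
  have ho := ckIsLittleO_zero.1 h.isLittleO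
  have hcont : ContinuousOn (fun p => fderivWithin ℝ G Q (u₀ p)) K :=
    (hG.continuousOn_fderivWithin hud (by simp)).comp (h.contDiffOn_zero.continuousOn.mono hKS)
      (h₀.mono_left hKS)
  obtain ⟨C, hC⟩ := hK.exists_bound_of_continuousOn hcont
  have hlin : ∀ r : ι → B → Z, (fun x : ι × B => fderivWithin ℝ G Q (u₀ x.2) (r x.1 x.2))
      =O[l ×ˢ 𝓟 K] fun x => r x.1 x.2 := fun r =>
    IsBigO.of_bound C (eventually_prod_principal_iff.2 (Eventually.of_forall fun i p hp =>
      ContinuousLinearMap.le_of_opNorm_le _ (hC p hp) _))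
  refine ⟨ckIsBigO_zero.2 ((hlin du).trans hO), ckIsLittleO_zero.2 ?_⟩
  have hdiff : (fun x : ι × B => u x.1 x.2 - u₀ x.2) =O[l ×ˢ 𝓟 K] fun x => b x.1 := by
    simpa using ho.isBigO.add hO
  have hsmall : Tendsto (fun x : ι × B => u x.1 x.2 - u₀ x.2) (l ×ˢ 𝓟 K) (𝓝 0) :=
    hdiff.trans_tendsto (hb.comp tendsto_fst)
  have hmain : (fun x : ι × B => G (u x.1 x.2) - G (u₀ x.2) -
      fderivWithin ℝ G Q (u₀ x.2) (u x.1 x.2 - u₀ x.2)) =o[l ×ˢ 𝓟 K]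
      fun x => u x.1 x.2 - u₀ x.2 := by
    refine IsLittleO.of_bound fun ε hε => ?_
    obtain ⟨δ, hδ, hδ'⟩ := hQ.exists_uniform_taylor (hG.of_le (by simp))
      (hK.image_of_continuousOn (h.contDiffOn_zero.continuousOn.mono hKS))
      (h₀.mono_left hKS).image_subset hε
    have h1 : ∀ᶠ x : ι × B in l ×ˢ 𝓟 K, ‖u x.1 x.2 - u₀ x.2‖ < δ := by
      simpa using Metric.tendsto_nhds.1 hsmall δ hδ
    have h2 : ∀ᶠ x : ι × B in l ×ˢ 𝓟 K, x.2 ∈ K ∧ u x.1 x.2 ∈ Q :=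
      eventually_prod_principal_iff.2 (hu.mono fun i hi p hp => ⟨hp, hi (hKS hp)⟩)
    filter_upwards [h1, h2] with x hx1 hx2
    exact hδ' _ (mem_image_of_mem _ hx2.1) _ hx2.2 hx1
  refine ((hmain.trans_isBigO hdiff).add ((hlin fun i p => u i p - u₀ p - du i p).trans_isLittleO ho)).congr_left fun x => ?_
  simp only [map_sub]
  abel

/-- The estimates in the chain rule for `C^k` expansions, by induction on `k`: the derivative of
`G ∘ u` is obtained from `(u, Du)` by composition with the smooth map `(z, A) ↦ DG z ∘ A`. The spaces
`Z` and `Y` share a universe which contains that of `B`, so that the induction can pass to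
`Z × (B →L[ℝ] Z)` and `B →L[ℝ] Y`. -/
theorem HasCkExpansion.isBigO_isLittleO_comp (k : ℕ) :
    ∀ {Z Y : Type (max w₁ w₂)} [NormedAddCommGroup Z] [NormedSpace ℝ Z]
    [NormedAddCommGroup Y] [NormedSpace ℝ Y] {Q : Set Z} (_ : IsConvexInterOpen Q) {G : Z → Y}
    (_ : ContDiffOn ℝ ∞ G Q) {S K : Set B} (_ : UniqueDiffOn ℝ S) (_ : K ⊆ S) (_ : IsCompact K)
    {l : Filter ι} {u : ι → B → Z} {u₀ : B → Z} {du : ι → B → Z} {b : ι → ℝ}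
    (_ : HasCkExpansion k S K l u u₀ du b) (_ : Tendsto b l (𝓝 0)) (_ : MapsTo u₀ S Q)
    (_ : ∀ᶠ i in l, MapsTo (u i) S Q),
    CkIsBigO k S K l (fun i p => fderivWithin ℝ G Q (u₀ p) (du i p)) b ∧
    CkIsLittleO k S K l
      (fun i p => G (u i p) - G (u₀ p) - fderivWithin ℝ G Q (u₀ p) (du i p)) b := by
  induction k with
  | zero =>
    intro Z Y _ _ _ _ Q hQ G hG S K hS hKS hK l u u₀ du b h hb h₀ hu
    have hud := hQ.uniqueDiffOn
    exact h.isBigO_isLittleO_comp_zero hQ hG hKS hK hb h₀ hu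
  | succ k ih =>
    intro Z Y _ _ _ _ Q hQ G hG S K hS hKS hK l u u₀ du b h hb h₀ hu
    have hud := hQ.uniqueDiffOn
    have hle : (k : WithTop ℕ∞) + 1 ≤ ((k + 1 : ℕ) : WithTop ℕ∞) := by simp
    have hle' : (k : WithTop ℕ∞) ≤ ((k + 1 : ℕ) : WithTop ℕ∞) := by
      exact_mod_cast Nat.le_succ k
    have hone : ((k + 1 : ℕ) : WithTop ℕ∞) ≠ 0 := by exact_mod_cast Nat.succ_ne_zero k
    set v : ι → B → Z × (B →L[ℝ] Z) := fun i p => (u i p, fderivWithin ℝ (u i) S p) with hv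
    set v₀ : B → Z × (B →L[ℝ] Z) := fun p => (u₀ p, fderivWithin ℝ u₀ S p) with hv₀
    set dv : ι → B → Z × (B →L[ℝ] Z) := fun i p => (du i p, fderivWithin ℝ (du i) S p) with hdv
    have hpair : ∀ {f : B → Z}, ContDiffOn ℝ ((k + 1 : ℕ) : WithTop ℕ∞) f S →
        ContDiffOn ℝ k (fun p => (f p, fderivWithin ℝ f S p)) S := fun hf =>
      (hf.of_le hle').prodMk (hf.fderivWithin hS hle)
    have hr : ∀ᶠ i in l, ContDiffOn ℝ ((k + 1 : ℕ) : WithTop ℕ∞)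
        (fun p => u i p - u₀ p - du i p) S := by
      filter_upwards [h.contDiffOn, h.contDiffOn_deriv] with i hi hi'
      exact (hi.sub h.contDiffOn_zero).sub hi'
    have hO := (ckIsBigO_succ hS hKS).1 h.isBigO
    have ho := (ckIsLittleO_succ hS hKS).1 h.isLittleO
    have hexp : HasCkExpansion k S K l v v₀ dv b := by
      refine ⟨hpair h.contDiffOn_zero, h.contDiffOn.mono fun i => hpair,
        h.contDiffOn_deriv.mono fun i => hpair, ?_, ?_⟩
      · exact CkIsBigO.prodMk hS hKS (h.contDiffOn_deriv.mono fun i hi => hi.of_le hle')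
          (h.contDiffOn_deriv.mono fun i hi => hi.fderivWithin hS hle)
          (fun j hj => h.isBigO j (by omega)) hO.2
      · refine (CkIsLittleO.prodMk hS hKS (hr.mono fun i hi => hi.of_le hle')
          (hr.mono fun i hi => hi.fderivWithin hS hle)
          (fun j hj => h.isLittleO j (by omega)) ho.2).congr hKS ?_
        filter_upwards [h.contDiffOn, h.contDiffOn_deriv] with i hi hi' p hp
        have d1 := (hi.differentiableOn hone) p hp
        have d2 := (h.contDiffOn_zero.differentiableOn hone) p hp
        have d3 := (hi'.differentiableOn hone) p hp
        simp only [hv, hv₀, hdv, Prod.mk_sub_mk, Prod.mk.injEq, true_and]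
        exact (((d1.hasFDerivWithinAt.sub d2.hasFDerivWithinAt).sub
          d3.hasFDerivWithinAt).fderivWithin (hS p hp))
    have hG1 : ContDiffOn ℝ ∞ (fderivWithin ℝ G Q) Q := hG.fderivWithin hud (by simp)
    have hH : ContDiffOn ℝ ∞ (fun z : Z × (B →L[ℝ] Z) => (fderivWithin ℝ G Q z.1).comp z.2)
        (Q ×ˢ univ) :=
      (hG1.comp contDiffOn_fst fun z hz => hz.1).clm_comp contDiffOn_snd
    obtain ⟨zO, zo⟩ := (h.of_le (Nat.zero_le _)).isBigO_isLittleO_comp_zero hQ hG hKS hK hb h₀ hu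
    obtain ⟨ihO, iho⟩ := ih (hQ.prod_univ (B →L[ℝ] Z)) hH hS hKS hK hexp hb
      (fun p hp => ⟨h₀ hp, mem_univ _⟩)
      (hu.mono fun i hi p hp => ⟨hi hp, mem_univ _⟩)
    have hD₀ := h.contDiffOn_zero.differentiableOn hone
    have hGd := hG.differentiableOn (by simp)
    have hcomp : ∀ {f : B → Z}, DifferentiableOn ℝ f S → MapsTo f S Q → ∀ p ∈ S,
        HasFDerivWithinAt (fun q => G (f q))
          ((fderivWithin ℝ G Q (f p)).comp (fderivWithin ℝ f S p)) S p := fun hf hfQ p hp =>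
      (hGd _ (hfQ hp)).hasFDerivWithinAt.comp p (hf p hp).hasFDerivWithinAt hfQ
    have hdir : ∀ {f : B → Z}, DifferentiableOn ℝ f S →
        DifferentiableOn ℝ (fun q => fderivWithin ℝ G Q (u₀ q) (f q)) S := fun hf =>
      ((hG1.differentiableOn (by simp)).comp hD₀ h₀).clm_apply hf
    refine ⟨(ckIsBigO_succ hS hKS).2 ⟨zO, ihO.congr hKS ?_⟩,
      (ckIsLittleO_succ hS hKS).2 ⟨zo, iho.congr hKS ?_⟩⟩
    · filter_upwards [h.contDiffOn_deriv] with i hi' p hp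
      exact (fderivWithin_fderivWithin_apply hQ hG hS hp h₀ (hD₀ p hp)
        (hi'.differentiableOn hone p hp)).symm
    · filter_upwards [h.contDiffOn, h.contDiffOn_deriv, hu] with i hi hi' hui p hp
      have d1 := hcomp (hi.differentiableOn hone) hui p hp
      have d2 := hcomp hD₀ h₀ p hp
      have d3 := (hdir (hi'.differentiableOn hone) p hp).hasFDerivWithinAt
      rw [fderivWithin_fderivWithin_apply hQ hG hS hp h₀ (hD₀ p hp)
        (hi'.differentiableOn hone p hp)] at d3
      exact (((d1.sub d2).sub d3).fderivWithin (hS p hp)).symm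

theorem CkIsBigO.clm_comp {Z Y : Type*} [NormedAddCommGroup Z] [NormedSpace ℝ Z]
    [NormedAddCommGroup Y] [NormedSpace ℝ Y] {k : ℕ} {S K : Set B} {l : Filter ι}
    {r : ι → B → Z} {b : ι → ℝ} (h : CkIsBigO k S K l r b) (A : Z →L[ℝ] Y)
    (hS : UniqueDiffOn ℝ S) (hKS : K ⊆ S) (hr : ∀ᶠ i in l, ContDiffOn ℝ k (r i) S) :
    CkIsBigO k S K l (fun i p => A (r i p)) b := fun j hj =>
  (IsBigO.of_bound (g := fun x : ι × B => iteratedFDerivWithin ℝ j (r x.1) S x.2) ‖A‖ (eventually_prod_principal_iff.2 (hr.mono fun _ hi p hp =>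
    A.norm_iteratedFDerivWithin_comp_left (N := k) (hi p (hKS hp)) hS (hKS hp)
      (by exact_mod_cast hj)))).trans (h j hj)

theorem CkIsLittleO.clm_comp {Z Y : Type*} [NormedAddCommGroup Z] [NormedSpace ℝ Z]
    [NormedAddCommGroup Y] [NormedSpace ℝ Y] {k : ℕ} {S K : Set B} {l : Filter ι}
    {r : ι → B → Z} {b : ι → ℝ} (h : CkIsLittleO k S K l r b) (A : Z →L[ℝ] Y)
    (hS : UniqueDiffOn ℝ S) (hKS : K ⊆ S) (hr : ∀ᶠ i in l, ContDiffOn ℝ k (r i) S) :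
    CkIsLittleO k S K l (fun i p => A (r i p)) b := fun j hj =>
  (IsBigO.of_bound (g := fun x : ι × B => iteratedFDerivWithin ℝ j (r x.1) S x.2) ‖A‖ (eventually_prod_principal_iff.2 (hr.mono fun _ hi p hp =>
    A.norm_iteratedFDerivWithin_comp_left (N := k) (hi p (hKS hp)) hS (hKS hp)
      (by exact_mod_cast hj)))).trans_isLittleO (h j hj)

universe w₃

/-- **Chain rule for `C^k` expansions.** Left composition with a smooth map `G` takes the expansion
`u i = u₀ + du i + o(b i)` to `G ∘ u i = G ∘ u₀ + DG(u₀) (du i) + o(b i)`. -/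
theorem HasCkExpansion.comp {Z : Type (max w₁ w₂ w₃)} {Y : Type w₃} [NormedAddCommGroup Z]
    [NormedSpace ℝ Z] [NormedAddCommGroup Y] [NormedSpace ℝ Y] {k : ℕ} {Q : Set Z}
    (hQ : IsConvexInterOpen Q) {G : Z → Y} (hG : ContDiffOn ℝ ∞ G Q) {S K : Set B}
    (hS : UniqueDiffOn ℝ S) (hKS : K ⊆ S) (hK : IsCompact K) {l : Filter ι} {u : ι → B → Z}
    {u₀ : B → Z} {du : ι → B → Z} {b : ι → ℝ} (h : HasCkExpansion k S K l u u₀ du b)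
    (hb : Tendsto b l (𝓝 0)) (h₀ : MapsTo u₀ S Q) (hu : ∀ᶠ i in l, MapsTo (u i) S Q) :
    HasCkExpansion k S K l (fun i p => G (u i p)) (fun p => G (u₀ p))
      (fun i p => fderivWithin ℝ G Q (u₀ p) (du i p)) b := by
  have hud := hQ.uniqueDiffOn
  have hGk : ContDiffOn ℝ k G Q := hG.of_le (by exact_mod_cast le_top)
  have hG1 : ContDiffOn ℝ k (fderivWithin ℝ G Q) Q :=
    (hG.fderivWithin (m := ∞) hud (by simp)).of_le (by exact_mod_cast le_top)
  have hc := hGk.comp h.contDiffOn_zero h₀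
  have hcu : ∀ᶠ i in l, ContDiffOn ℝ k (fun p => G (u i p)) S := by
    filter_upwards [h.contDiffOn, hu] with i hi hi'
    exact hGk.comp hi hi'
  have hcd : ∀ᶠ i in l, ContDiffOn ℝ k (fun p => fderivWithin ℝ G Q (u₀ p) (du i p)) S :=
    h.contDiffOn_deriv.mono fun i hi => (hG1.comp h.contDiffOn_zero h₀).clm_apply hi
  -- `isBigO_isLittleO_comp` needs `Z` and `Y` in the same universe, so `Y` is lifted.
  let e : ULift.{max w₁ w₂} Y ≃L[ℝ] Y := ContinuousLinearEquiv.ulift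
  obtain ⟨hO, ho⟩ := HasCkExpansion.isBigO_isLittleO_comp.{w₁, max w₂ w₃} k hQ
    (G := fun z => e.symm (G z)) (e.symm.contDiff.comp_contDiffOn hG) hS hKS hK h hb h₀ hu
  have hderiv : ∀ p ∈ S, ∀ ζ : Z, fderivWithin ℝ (fun z => e.symm (G z)) Q (u₀ p) ζ =
      e.symm (fderivWithin ℝ G Q (u₀ p) ζ) := fun p hp ζ => by
    have := e.symm.comp_fderivWithin (f := G) (hud _ (h₀ hp))
    exact congrArg (fun A => A ζ) this
  refine ⟨hc, hcu, hcd, ?_, ?_⟩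
  · have h1 : CkIsBigO k S K l (fun i p => e.symm (fderivWithin ℝ G Q (u₀ p) (du i p))) b :=
      hO.congr hKS (Eventually.of_forall fun i p hp => hderiv p hp _)
    exact h1.clm_comp (e : ULift.{max w₁ w₂} Y →L[ℝ] Y) hS hKS
      (hcd.mono fun i hi => e.symm.contDiff.comp_contDiffOn hi)
  · have h1 : CkIsLittleO k S K l (fun i p => e.symm (G (u i p) - G (u₀ p) -
        fderivWithin ℝ G Q (u₀ p) (du i p))) b :=
      ho.congr hKS (Eventually.of_forall fun i p hp => by
        simp only [hderiv p hp, map_sub])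
    exact h1.clm_comp (e : ULift.{max w₁ w₂} Y →L[ℝ] Y) hS hKS (by
      filter_upwards [hcu, hcd] with i hi hi'
      exact e.symm.contDiff.comp_contDiffOn ((hi.sub hc).sub hi'))

end Expansion

/-! ### Chart domains as convex sets cut by open sets -/

section Charts

variable {B H : Type*} [NormedAddCommGroup B] [NormedSpace ℝ B] [TopologicalSpace H]
  {I : ModelWithCorners ℝ B H} {D : Type*} [TopologicalSpace D] [ChartedSpace H D]

/-- The part of the target of the chart at `x` which corresponds to the set `U`. -/
def chartImage (I : ModelWithCorners ℝ B H) (x : D) (U : Set D) : Set B :=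
  (extChartAt I x).target ∩ (extChartAt I x).symm ⁻¹' U

theorem isConvexInterOpen_chartImage (x : D) {U : Set D} (hU : IsOpen U) :
    IsConvexInterOpen (chartImage I x U) := by
  refine ⟨range I, I.symm ⁻¹' ((chartAt H x).target ∩ (chartAt H x).symm ⁻¹' U), I.convex_range,
    I.nonempty_interior, ((chartAt H x).isOpen_inter_preimage_symm hU).preimage
      I.continuous_symm, ?_⟩
  rw [chartImage, extChartAt_target, extChartAt_coe_symm, preimage_comp, preimage_inter, inter_assoc]
  rw [inter_left_comm]

theorem extChartAt_mem_chartImage {x : D} {U : Set D} {p : D} (hp : p ∈ (extChartAt I x).source)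
    (hpU : p ∈ U) : extChartAt I x p ∈ chartImage I x U :=
  ⟨(extChartAt I x).map_source hp, by rwa [mem_preimage, (extChartAt I x).left_inv hp]⟩

theorem iteratedFDerivWithin_chartImage {W : Type*} [NormedAddCommGroup W] [NormedSpace ℝ W]
    (f : B → W) (x : D) {U : Set D} (hU : IsOpen U) {p : D} (hp : p ∈ (extChartAt I x).source)
    (hpU : p ∈ U) (j : ℕ) :
    iteratedFDerivWithin ℝ j f (chartImage I x U) (extChartAt I x p) =
      iteratedFDerivWithin ℝ j f (extChartAt I x).target (extChartAt I x p) := by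
  refine iteratedFDerivWithin_inter' ?_
  refine (continuousOn_extChartAt_symm x _ ((extChartAt I x).map_source hp)).preimage_mem_nhdsWithin ?_
  rw [(extChartAt I x).left_inv hp]
  exact hU.mem_nhds hpU

theorem contDiffOn_chartImage {W : Type*} [NormedAddCommGroup W] [NormedSpace ℝ W]
    {n : WithTop ℕ∞} [IsManifold I n D] {g : D → W} {U : Set D} (hg : ContMDiffOn I 𝓘(ℝ, W) n g U)
    (x : D) : ContDiffOn ℝ n (fun b => g ((extChartAt I x).symm b)) (chartImage I x U) := by
  rw [← contMDiffOn_iff_contDiffOn]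
  exact hg.comp ((contMDiffOn_extChartAt_symm x).mono inter_subset_left) fun b hb => hb.2

end Charts

/-! ### Estimates in the space of `C^k` maps -/

section CkEstimates

variable {B H : Type*} [NormedAddCommGroup B] [NormedSpace ℝ B] [TopologicalSpace H]
  {I : ModelWithCorners ℝ B H} {D : Type*} [TopologicalSpace D] [ChartedSpace H D]
  [IsManifold I ∞ D] [CompactSpace D] [T2Space D]
  {B' H' : Type*} [NormedAddCommGroup B'] [NormedSpace ℝ B'] [TopologicalSpace H']
  {I' : ModelWithCorners ℝ B' H'} {D' : Type*} [TopologicalSpace D'] [ChartedSpace H' D']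
  [IsManifold I' ∞ D'] [CompactSpace D'] [T2Space D']
  {W W₁ W₂ Y : Type*} [NormedAddCommGroup W] [NormedSpace ℝ W]
  [NormedAddCommGroup W₁] [NormedSpace ℝ W₁] [NormedAddCommGroup W₂] [NormedSpace ℝ W₂]
  [NormedAddCommGroup Y] [NormedSpace ℝ Y] {k : ℕ}

namespace ContMDiffMap

theorem norm_iteratedFDerivWithin_le_norm (f : C^k⟮I, D; 𝓘(ℝ, W), W⟯) {x p : D}
    (hx : x ∈ (compactChartCover I D).index) (hp : p ∈ (compactChartCover I D).piece x) {j : ℕ}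
    (hj : j ≤ k) : ‖iteratedFDerivWithin ℝ j (f ∘ (extChartAt I x).symm) (extChartAt I x).target
      (extChartAt I x p)‖ ≤ ‖f‖ := by
  have h1 := norm_le_pi_norm (ckJet f) ⟨x, hx⟩
  have h2 := norm_le_pi_norm (ckJet f ⟨x, hx⟩) (⟨j, Nat.lt_succ_of_le hj⟩ : Fin (k + 1))
  have h3 := (ckJet f ⟨x, hx⟩ (⟨j, Nat.lt_succ_of_le hj⟩ : Fin (k + 1))).norm_coe_le_norm ⟨p, hp⟩
  exact (h3.trans h2).trans h1

theorem norm_le_of_forall_iteratedFDerivWithin_le (f : C^k⟮I, D; 𝓘(ℝ, W), W⟯) {C : ℝ} (hC : 0 ≤ C)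
    (h : ∀ x ∈ (compactChartCover I D).index, ∀ p ∈ (compactChartCover I D).piece x, ∀ j ≤ k,
      ‖iteratedFDerivWithin ℝ j (f ∘ (extChartAt I x).symm) (extChartAt I x).target
        (extChartAt I x p)‖ ≤ C) : ‖f‖ ≤ C := by
  change ‖ckJet f‖ ≤ C
  refine (pi_norm_le_iff_of_nonneg hC).2 fun x => (pi_norm_le_iff_of_nonneg hC).2 fun j =>
    (ContinuousMap.norm_le _ hC).2 fun p => ?_
  exact h x x.2 p p.2 j (Nat.lt_succ_iff.mp j.2)

theorem norm_apply_le (f : C^k⟮I, D; 𝓘(ℝ, W), W⟯) (p : D) : ‖f p‖ ≤ ‖f‖ := by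
  obtain ⟨x, hx, hp⟩ := (compactChartCover I D).cover p
  have h := f.norm_iteratedFDerivWithin_le_norm hx hp (Nat.zero_le k)
  rwa [norm_iteratedFDerivWithin_zero, Function.comp_apply,
    (extChartAt I x).left_inv ((compactChartCover I D).piece_subset x hp)] at h

/-- The pointwise application of a continuous bilinear map to two `C^k` maps. -/
noncomputable def bilin (β : W₁ →L[ℝ] W₂ →L[ℝ] Y) (f : C^k⟮I, D; 𝓘(ℝ, W₁), W₁⟯)
    (g : C^k⟮I, D; 𝓘(ℝ, W₂), W₂⟯) : C^k⟮I, D; 𝓘(ℝ, Y), Y⟯ :=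
  ⟨fun p => β (f p) (g p), (β.contMDiff.comp f.contMDiff).clm_apply g.contMDiff⟩

theorem norm_bilin_le (β : W₁ →L[ℝ] W₂ →L[ℝ] Y) (f : C^k⟮I, D; 𝓘(ℝ, W₁), W₁⟯)
    (g : C^k⟮I, D; 𝓘(ℝ, W₂), W₂⟯) : ‖bilin β f g‖ ≤ ‖β‖ * 2 ^ k * ‖f‖ * ‖g‖ := by
  refine norm_le_of_forall_iteratedFDerivWithin_le _ (by positivity) fun x hx p hp j hj => ?_
  have hps := (extChartAt I x).map_source ((compactChartCover I D).piece_subset x hp)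
  refine (β.norm_iteratedFDerivWithin_le_of_bilinear (contDiffOn_chart_expression f x)
    (contDiffOn_chart_expression g x) (uniqueDiffOn_extChartAt_target x) hps
    (by exact_mod_cast hj)).trans ?_
  have h : ∑ i ∈ Finset.range (j + 1), (j.choose i : ℝ) *
      ‖iteratedFDerivWithin ℝ i (f ∘ (extChartAt I x).symm) (extChartAt I x).target
        (extChartAt I x p)‖ *
      ‖iteratedFDerivWithin ℝ (j - i) (g ∘ (extChartAt I x).symm) (extChartAt I x).target
        (extChartAt I x p)‖ ≤ ∑ i ∈ Finset.range (j + 1), (j.choose i : ℝ) * ‖f‖ * ‖g‖ := by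
    refine Finset.sum_le_sum fun i hi => ?_
    have hi' : i ≤ j := Nat.lt_succ_iff.1 (Finset.mem_range.1 hi)
    gcongr
    · exact f.norm_iteratedFDerivWithin_le_norm hx hp (hi'.trans hj)
    · exact g.norm_iteratedFDerivWithin_le_norm hx hp ((Nat.sub_le _ _).trans hj)
  have h2 : ∑ i ∈ Finset.range (j + 1), (j.choose i : ℝ) * ‖f‖ * ‖g‖ = 2 ^ j * ‖f‖ * ‖g‖ := by
    rw [← Finset.sum_mul, ← Finset.sum_mul]
    congr 2
    exact_mod_cast Nat.sum_range_choose j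
  calc _ ≤ ‖β‖ * (2 ^ j * ‖f‖ * ‖g‖) := by
        rw [← h2]
        gcongr
    _ ≤ ‖β‖ * (2 ^ k * ‖f‖ * ‖g‖) := by
        gcongr
        norm_num
    _ = _ := by ring

/-- The pointwise application of a continuous bilinear map, as a continuous bilinear map between
spaces of `C^k` maps. -/
noncomputable def bilinCLM (β : W₁ →L[ℝ] W₂ →L[ℝ] Y) : C^k⟮I, D; 𝓘(ℝ, W₁), W₁⟯ →L[ℝ]
    C^k⟮I, D; 𝓘(ℝ, W₂), W₂⟯ →L[ℝ] C^k⟮I, D; 𝓘(ℝ, Y), Y⟯ :=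
  LinearMap.mkContinuous₂ (LinearMap.mk₂ ℝ (bilin β)
    (fun f f' g => by
      ext p
      change β (f p + f' p) (g p) = β (f p) (g p) + β (f' p) (g p)
      simp)
    (fun c f g => by
      ext p
      change β (c • f p) (g p) = c • β (f p) (g p)
      simp)
    (fun f g g' => by
      ext p
      change β (f p) (g p + g' p) = β (f p) (g p) + β (f p) (g' p)
      simp)
    (fun c f g => by
      ext p
      change β (f p) (c • g p) = c • β (f p) (g p)
      simp)) (‖β‖ * 2 ^ k) (norm_bilin_le β)

omit [IsManifold I' ∞ D'] in
/-- The norm may be estimated on the pieces obtained by intersecting those of the chosen cover of `D`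
with the preimages of those of the chosen cover of `D'`; the derivatives may be taken within the
corresponding parts of the chart targets. -/
theorem norm_le_of_forall_refined {φ : D → D'} (hφ : Continuous φ) (f : C^k⟮I, D; 𝓘(ℝ, W), W⟯)
    {C : ℝ} (hC : 0 ≤ C)
    (h : ∀ x ∈ (compactChartCover I D).index, ∀ y ∈ (compactChartCover I' D').index,
      ∀ j ≤ k, ∀ p ∈ (compactChartCover I D).piece x, φ p ∈ (compactChartCover I' D').piece y →
      ‖iteratedFDerivWithin ℝ j (fun b => f ((extChartAt I x).symm b))
        (chartImage I x (φ ⁻¹' (extChartAt I' y).source)) (extChartAt I x p)‖ ≤ C) : ‖f‖ ≤ C := by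
  refine norm_le_of_forall_iteratedFDerivWithin_le _ hC fun x hx p hp j hj => ?_
  obtain ⟨y, hy, hpy⟩ := (compactChartCover I' D').cover (φ p)
  have h1 := h x hx y hy j hj p hp hpy
  rwa [iteratedFDerivWithin_chartImage _ x ((isOpen_extChartAt_source y).preimage hφ)
    ((compactChartCover I D).piece_subset x hp) ((compactChartCover I' D').piece_subset y hpy)] at h1

omit [CompactSpace D] [T2Space D] [CompactSpace D'] [T2Space D'] in
theorem contDiffOn_writtenInExtChartAt {φ : D → D'} (hφ : ContMDiff I I' k φ) (x : D) (y : D') :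
    ContDiffOn ℝ k (fun b => extChartAt I' y (φ ((extChartAt I x).symm b)))
      (chartImage I x (φ ⁻¹' (extChartAt I' y).source)) := by
  have : IsManifold I k D := IsManifold.of_le (n := ∞) (by exact_mod_cast le_top)
  have : IsManifold I' k D' := IsManifold.of_le (n := ∞) (by exact_mod_cast le_top)
  refine contDiffOn_chartImage (g := fun p => extChartAt I' y (φ p)) ?_ x
  refine (contMDiffOn_extChartAt (n := k)).comp hφ.contMDiffOn fun p hp => ?_
  rw [← extChartAt_source (I := I')]
  exact hp

omit [IsManifold I ∞ D] [IsManifold I' ∞ D'] in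
theorem isCompact_refinedPiece {φ : D → D'} (hφ : Continuous φ) (x : D) (y : D') :
    IsCompact (extChartAt I x '' ((compactChartCover I D).piece x ∩
      φ ⁻¹' (compactChartCover I' D').piece y)) := by
  refine IsCompact.image_of_continuousOn ?_ ((continuousOn_extChartAt x).mono
    (inter_subset_left.trans ((compactChartCover I D).piece_subset x)))
  exact ((compactChartCover I D).isCompact_piece x).inter_right
    (((compactChartCover I' D').isCompact_piece y).isClosed.preimage hφ)

omit [IsManifold I ∞ D] [IsManifold I' ∞ D'] in
theorem refinedPiece_subset (φ : D → D') (x : D) (y : D') :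
    extChartAt I x '' ((compactChartCover I D).piece x ∩ φ ⁻¹' (compactChartCover I' D').piece y) ⊆
      chartImage I x (φ ⁻¹' (extChartAt I' y).source) := by
  rintro _ ⟨p, hp, rfl⟩
  exact extChartAt_mem_chartImage ((compactChartCover I D).piece_subset x hp.1)
    ((compactChartCover I' D').piece_subset y hp.2)

/-- Composition with a map of class `C^k`. -/
noncomputable def pullback (φ : C^k⟮I, D; I', D'⟯) (f : C^k⟮I', D'; 𝓘(ℝ, W), W⟯) : C^k⟮I, D; 𝓘(ℝ, W), W⟯ :=
  f.comp φ

theorem exists_norm_pullback_le (φ : C^k⟮I, D; I', D'⟯) :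
    ∃ C, ∀ f : C^k⟮I', D'; 𝓘(ℝ, W), W⟯, ‖pullback φ f‖ ≤ C * ‖f‖ := by
  have hφ := φ.contMDiff.continuous
  have hS : ∀ x y, IsConvexInterOpen (chartImage I x (φ ⁻¹' (extChartAt I' y).source)) :=
    fun x y => isConvexInterOpen_chartImage x ((isOpen_extChartAt_source y).preimage hφ)
  have key : ∀ (x : D) (y : D') (j : Fin (k + 1)), ∃ M, ∀ b ∈ extChartAt I x ''
      ((compactChartCover I D).piece x ∩ φ ⁻¹' (compactChartCover I' D').piece y),
      ‖iteratedFDerivWithin ℝ j (fun b => extChartAt I' y (φ ((extChartAt I x).symm b)))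
        (chartImage I x (φ ⁻¹' (extChartAt I' y).source)) b‖ ≤ M := fun x y j =>
    (isCompact_refinedPiece hφ x y).exists_bound_of_continuousOn
      (((contDiffOn_writtenInExtChartAt φ.contMDiff x y).continuousOn_iteratedFDerivWithin
        (by exact_mod_cast Nat.lt_succ_iff.1 j.2) (hS x y).uniqueDiffOn).mono
        (refinedPiece_subset φ x y))
  choose M hM using key
  -- A common bound, at least `1`, for the derivatives of `φ` in the charts: then `R` is at most `R ^ i`
  -- for `1 ≤ i`, the form of bound which the estimate for derivatives of compositions requires.
  set R : ℝ := 1 + ∑ x ∈ (compactChartCover I D).index, ∑ y ∈ (compactChartCover I' D').index,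
    ∑ j, |M x y j| with hR
  have hR1 : 1 ≤ R := le_add_of_nonneg_right (by positivity)
  have hMR : ∀ x ∈ (compactChartCover I D).index, ∀ y ∈ (compactChartCover I' D').index, ∀ j,
      M x y j ≤ R := fun x hx y hy j => by
    calc M x y j ≤ |M x y j| := le_abs_self _
      _ ≤ ∑ j, |M x y j| := Finset.single_le_sum (f := fun j => |M x y j|)
          (fun _ _ => abs_nonneg _) (Finset.mem_univ j)
      _ ≤ ∑ y ∈ (compactChartCover I' D').index, ∑ j, |M x y j| :=
          Finset.single_le_sum (f := fun y => ∑ j, |M x y j|) (fun _ _ => by positivity) hy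
      _ ≤ ∑ x ∈ (compactChartCover I D).index, ∑ y ∈ (compactChartCover I' D').index,
          ∑ j, |M x y j| :=
          Finset.single_le_sum (f := fun x => ∑ y ∈ (compactChartCover I' D').index, ∑ j, |M x y j|)
            (fun _ _ => by positivity) hx
      _ ≤ R := by rw [hR]; linarith
  refine ⟨k.factorial * R ^ k, fun f => ?_⟩
  refine norm_le_of_forall_refined (I' := I') hφ _ (by positivity) fun x hx y hy j hj p hp hpy => ?_
  set S := chartImage I x (φ ⁻¹' (extChartAt I' y).source)
  set ψ : B → B' := fun b => extChartAt I' y (φ ((extChartAt I x).symm b)) with hψ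
  have hpS : extChartAt I x p ∈ S :=
    refinedPiece_subset (I := I) (I' := I') φ x y ⟨p, ⟨hp, hpy⟩, rfl⟩
  have hmaps : MapsTo ψ S (extChartAt I' y).target := fun b hb => (extChartAt I' y).map_source hb.2
  have heq : EqOn (fun b => pullback φ f ((extChartAt I x).symm b))
      ((f ∘ (extChartAt I' y).symm) ∘ ψ) S := fun b hb => by
    simp only [hψ, Function.comp_apply, (extChartAt I' y).left_inv hb.2]
    rfl
  have hjk : (j : WithTop ℕ∞) ≤ k := by exact_mod_cast hj
  rw [iteratedFDerivWithin_congr heq hpS]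
  have hψp : ψ (extChartAt I x p) = extChartAt I' y (φ p) := by
    simp only [hψ, (extChartAt I x).left_inv ((compactChartCover I D).piece_subset x hp)]
  refine (norm_iteratedFDerivWithin_comp_le (N := k) (contDiffOn_chart_expression f y)
    (contDiffOn_writtenInExtChartAt φ.contMDiff x y) hjk
    (uniqueDiffOn_extChartAt_target y) (hS x y).uniqueDiffOn hmaps hpS (C := ‖f‖) (D := R)
    (fun i hi => ?_) (fun i h1 hi => ?_)).trans ?_
  · change ‖iteratedFDerivWithin ℝ i _ _ (ψ (extChartAt I x p))‖ ≤ _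
    rw [hψp]
    exact f.norm_iteratedFDerivWithin_le_norm hy hpy (hi.trans hj)
  · refine (hM x y ⟨i, by omega⟩ _ ⟨p, ⟨hp, hpy⟩, rfl⟩).trans ((hMR x hx y hy _).trans ?_)
    exact le_self_pow₀ hR1 (by omega)
  · have h1 : (j.factorial : ℝ) ≤ k.factorial := by exact_mod_cast Nat.factorial_le hj
    have h2 : R ^ j ≤ R ^ k := pow_le_pow_right₀ hR1 hj
    calc (j.factorial : ℝ) * ‖f‖ * R ^ j ≤ k.factorial * ‖f‖ * R ^ k := by gcongr
      _ = _ := by ring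

/-- Composition with a map of class `C^k`, as a continuous linear map between spaces of `C^k`
maps. -/
noncomputable def pullbackCLM (φ : C^k⟮I, D; I', D'⟯) :
    C^k⟮I', D'; 𝓘(ℝ, W), W⟯ →L[ℝ] C^k⟮I, D; 𝓘(ℝ, W), W⟯ :=
  LinearMap.mkContinuousOfExistsBound
    { toFun := pullback φ
      map_add' := fun _ _ => rfl
      map_smul' := fun _ _ => rfl } (exists_norm_pullback_le φ)

end ContMDiffMap

end CkEstimates

/-! ### Superposition operators between spaces of `C^k` maps -/

section Superposition

open Asymptotics

universe w₁ w₂ w₃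

variable {B : Type w₁} {H : Type*} [NormedAddCommGroup B] [NormedSpace ℝ B] [TopologicalSpace H]
  {I : ModelWithCorners ℝ B H} {D : Type*} [TopologicalSpace D] [ChartedSpace H D]
  [IsManifold I ∞ D]
  {B' : Type w₂} {H' : Type*} [NormedAddCommGroup B'] [NormedSpace ℝ B'] [TopologicalSpace H']
  {I' : ModelWithCorners ℝ B' H'} {D' : Type*} [TopologicalSpace D'] [ChartedSpace H' D']
  [IsManifold I' ∞ D']
  {W Y : Type w₃} [NormedAddCommGroup W] [NormedSpace ℝ W]
  [NormedAddCommGroup Y] [NormedSpace ℝ Y] {k : ℕ}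

/-- The partial derivative of `g : D × D' × W → Y` in the direction of `W`. -/
noncomputable def fibreDeriv (g : D × D' × W → Y) (z : D × D' × W) : W →L[ℝ] Y :=
  fderiv ℝ (fun w => g (z.1, z.2.1, w)) z.2.2

theorem ContMDiffOn.fibreDeriv {g : D × D' × W → Y} {U : Set (D × D' × W)} (hU : IsOpen U)
    (hg : ContMDiffOn (I.prod (I'.prod 𝓘(ℝ, W))) 𝓘(ℝ, Y) ∞ g U) :
    ContMDiffOn (I.prod (I'.prod 𝓘(ℝ, W))) 𝓘(ℝ, W →L[ℝ] Y) ∞ (fibreDeriv g) U := by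
  intro z hz
  have h1 : ContMDiffAt ((I.prod (I'.prod 𝓘(ℝ, W))).prod 𝓘(ℝ, W)) 𝓘(ℝ, Y) ∞
      (Function.uncurry fun (z : D × D' × W) (w : W) => g (z.1, z.2.1, w)) (z, z.2.2) := by
    refine ContMDiffAt.comp (I' := I.prod (I'.prod 𝓘(ℝ, W))) (g := g)
      (f := fun x : (D × D' × W) × W => (x.1.1, x.1.2.1, x.2)) (z, z.2.2)
      (hg.contMDiffAt (hU.mem_nhds hz)) ?_
    exact (contMDiff_fst.comp contMDiff_fst).prodMk ((contMDiff_fst.comp (contMDiff_snd.comp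
      contMDiff_fst)).prodMk contMDiff_snd) |>.contMDiffAt
  have h2 := ContMDiffAt.mfderiv (J := I.prod (I'.prod 𝓘(ℝ, W))) (m := ∞) (n := ∞) (x₀ := z)
    (fun (z : D × D' × W) (w : W) => g (z.1, z.2.1, w)) (fun z => z.2.2) h1
    (contMDiffAt_snd.comp z contMDiffAt_snd) (by simp)
  have h3 : inTangentCoordinates 𝓘(ℝ, W) 𝓘(ℝ, Y) (fun z : D × D' × W => z.2.2)
      (fun z => g (z.1, z.2.1, z.2.2)) (_root_.fibreDeriv g) z = _root_.fibreDeriv g :=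
    inTangentCoordinates_model_space _ _ _ _
  simp only [mfderiv_eq_fderiv] at h2
  change ContMDiffAt _ _ _ (inTangentCoordinates 𝓘(ℝ, W) 𝓘(ℝ, Y) (fun z : D × D' × W => z.2.2)
    (fun z => g (z.1, z.2.1, z.2.2)) (_root_.fibreDeriv g) z) z at h2
  exact (h3 ▸ h2).contMDiffWithinAt

omit [IsManifold I ∞ D] [IsManifold I' ∞ D'] in
theorem hasFDerivAt_fibre {g : D × D' × W → Y} {U : Set (D × D' × W)} (hU : IsOpen U)
    (hg : ContMDiffOn (I.prod (I'.prod 𝓘(ℝ, W))) 𝓘(ℝ, Y) ∞ g U) {p : D} {q : D'} {w : W}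
    (hz : (p, q, w) ∈ U) :
    HasFDerivAt (fun w => g (p, q, w)) (fibreDeriv g (p, q, w)) w := by
  have h1 : ContMDiffAt 𝓘(ℝ, W) 𝓘(ℝ, Y) ∞ (fun w => g (p, q, w)) w :=
    ContMDiffAt.comp (I' := I.prod (I'.prod 𝓘(ℝ, W))) (g := g) (f := fun w : W => (p, q, w)) w
      (hg.contMDiffAt (hU.mem_nhds hz))
      (contMDiffAt_const.prodMk (contMDiffAt_const.prodMk contMDiffAt_id))
  exact (h1.contDiffAt.differentiableAt (by simp)).hasFDerivAt

/-- The maps `w : D → W` for which `(p, φ p, w p)` stays in `U`. -/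
def superpositionDomain (φ : C^k⟮I, D; I', D'⟯) (U : Set (D × D' × W)) :
    Set C^k⟮I, D; 𝓘(ℝ, W), W⟯ :=
  {w | ∀ p, (p, φ p, w p) ∈ U}

open Classical in
/-- The superposition operator `w ↦ (p ↦ g (p, φ p, w p))`, extended by `0`. The map `φ` is only of
class `C^k`, whereas `g` is smooth: this makes the operator smooth. -/
noncomputable def superposition (φ : C^k⟮I, D; I', D'⟯) {g : D × D' × W → Y}
    {U : Set (D × D' × W)} (hg : ContMDiffOn (I.prod (I'.prod 𝓘(ℝ, W))) 𝓘(ℝ, Y) ∞ g U)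
    (w : C^k⟮I, D; 𝓘(ℝ, W), W⟯) : C^k⟮I, D; 𝓘(ℝ, Y), Y⟯ :=
  if h : w ∈ superpositionDomain φ U then
    ⟨fun p => g (p, φ p, w p), (hg.of_le (by exact_mod_cast le_top)).comp_contMDiff
      (contMDiff_id.prodMk (φ.contMDiff.prodMk w.contMDiff)) h⟩
  else 0

omit [IsManifold I ∞ D] [IsManifold I' ∞ D'] in
theorem superposition_apply (φ : C^k⟮I, D; I', D'⟯) {g : D × D' × W → Y}
    {U : Set (D × D' × W)} (hg : ContMDiffOn (I.prod (I'.prod 𝓘(ℝ, W))) 𝓘(ℝ, Y) ∞ g U)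
    {w : C^k⟮I, D; 𝓘(ℝ, W), W⟯} (hw : w ∈ superpositionDomain φ U) (p : D) :
    superposition φ hg w p = g (p, φ p, w p) := by
  have h : superposition φ hg w = ⟨fun p => g (p, φ p, w p), _⟩ := dif_pos hw
  rw [h]
  rfl

variable [CompactSpace D] [T2Space D]

theorem continuous_ckEval {X : Type*} [NormedAddCommGroup X] [NormedSpace ℝ X] :
    Continuous fun x : C^k⟮I, D; 𝓘(ℝ, X), X⟯ × D => x.1 x.2 := by
  refine continuous_iff_continuousAt.2 fun ⟨w₀, p⟩ => ?_
  have h1 : Tendsto (fun x : C^k⟮I, D; 𝓘(ℝ, X), X⟯ × D => (x.1 - w₀) x.2) (𝓝 (w₀, p)) (𝓝 0) := by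
    refine squeeze_zero_norm (fun x => (x.1 - w₀).norm_apply_le x.2) ?_
    have : Continuous fun x : C^k⟮I, D; 𝓘(ℝ, X), X⟯ × D => ‖x.1 - w₀‖ := by fun_prop
    simpa using this.tendsto (w₀, p)
  have h2 : Tendsto (fun x : C^k⟮I, D; 𝓘(ℝ, X), X⟯ × D => w₀ x.2) (𝓝 (w₀, p)) (𝓝 (w₀ p)) :=
    (w₀.contMDiff.continuous.comp continuous_snd).tendsto (w₀, p)
  have h3 := h1.add h2
  rw [zero_add] at h3
  refine h3.congr fun x => ?_
  change x.1 x.2 - w₀ x.2 + w₀ x.2 = x.1 x.2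
  abel

omit [IsManifold I' ∞ D'] in
theorem isOpen_superpositionDomain (φ : C^k⟮I, D; I', D'⟯) {U : Set (D × D' × W)}
    (hU : IsOpen U) : IsOpen (superpositionDomain φ U) := by
  refine isOpen_iff_mem_nhds.2 fun w₀ hw₀ => ?_
  have hc : Continuous fun x : C^k⟮I, D; 𝓘(ℝ, W), W⟯ × D => (x.2, φ x.2, x.1 x.2) :=
    continuous_snd.prodMk ((φ.contMDiff.continuous.comp continuous_snd).prodMk continuous_ckEval)
  have h := isCompact_univ.eventually_forall_of_forall_eventually (x₀ := w₀)
    (P := fun (w : C^k⟮I, D; 𝓘(ℝ, W), W⟯) (p : D) => (p, φ p, w p) ∈ U)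
    fun p _ => (hU.preimage hc).mem_nhds (hw₀ p)
  filter_upwards [h] with w hw p using hw p (mem_univ p)

variable [CompactSpace D'] [T2Space D']

/-- The candidate for the derivative of the superposition operator with kernel `g`: the pointwise
application of the values of the superposition operator with kernel `fibreDeriv g`. -/
noncomputable def superpositionDeriv (φ : C^k⟮I, D; I', D'⟯) {g : D × D' × W → Y}
    {U : Set (D × D' × W)} (hU : IsOpen U)
    (hg : ContMDiffOn (I.prod (I'.prod 𝓘(ℝ, W))) 𝓘(ℝ, Y) ∞ g U)
    (w : C^k⟮I, D; 𝓘(ℝ, W), W⟯) : C^k⟮I, D; 𝓘(ℝ, W), W⟯ →L[ℝ] C^k⟮I, D; 𝓘(ℝ, Y), Y⟯ :=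
  ContMDiffMap.bilinCLM (ContinuousLinearMap.id ℝ (W →L[ℝ] Y))
    (superposition φ (hg.fibreDeriv hU) w)

/-- In charts of `D` and `D'`, and over a compact set, the remainder of order one of the
superposition operator is `o(‖w - w₀‖)` together with its derivatives of order at most `k`. -/
theorem superposition_local_estimate (φ : C^k⟮I, D; I', D'⟯) {g : D × D' × W → Y}
    {U : Set (D × D' × W)} (hU : IsOpen U)
    (hg : ContMDiffOn (I.prod (I'.prod 𝓘(ℝ, W))) 𝓘(ℝ, Y) ∞ g U)
    {w₀ : C^k⟮I, D; 𝓘(ℝ, W), W⟯} (hw₀ : w₀ ∈ superpositionDomain φ U) (x : D)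
    (hx : x ∈ (compactChartCover I D).index) (y : D') :
    CkIsLittleO k (chartImage I x (φ ⁻¹' (extChartAt I' y).source))
      (extChartAt I x '' ((compactChartCover I D).piece x ∩
        φ ⁻¹' (compactChartCover I' D').piece y)) (𝓝 w₀)
      (fun w b => (superposition φ hg w - superposition φ hg w₀ -
        superpositionDeriv φ hU hg w₀ (w - w₀)) ((extChartAt I x).symm b)) fun w => ‖w - w₀‖ := by
  have hφ : Continuous φ := φ.contMDiff.continuous
  have hop : IsOpen (φ ⁻¹' (extChartAt I' y).source) := (isOpen_extChartAt_source y).preimage hφ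
  set S := chartImage I x (φ ⁻¹' (extChartAt I' y).source) with hS
  set K := extChartAt I x '' ((compactChartCover I D).piece x ∩
        φ ⁻¹' (compactChartCover I' D').piece y) with hK
  have hSc : IsConvexInterOpen S := isConvexInterOpen_chartImage x hop
  have hSu := hSc.uniqueDiffOn
  have hKS : K ⊆ S := ContMDiffMap.refinedPiece_subset φ x y
  have hKc : IsCompact K := ContMDiffMap.isCompact_refinedPiece hφ x y
  have hE : extChartAt (I.prod (I'.prod 𝓘(ℝ, W))) (x, y, (0 : W)) =
      (extChartAt I x).prod ((extChartAt I' y).prod (PartialEquiv.refl W)) := by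
    rw [extChartAt_prod, extChartAt_prod, extChartAt_model_space_eq_id]
  set Q := chartImage (I.prod (I'.prod 𝓘(ℝ, W))) (x, y, (0 : W)) U with hQ
  have hQc : IsConvexInterOpen Q := isConvexInterOpen_chartImage _ hU
  set G : B × B' × W → Y := fun z =>
    g ((extChartAt (I.prod (I'.prod 𝓘(ℝ, W))) (x, y, (0 : W))).symm z) with hG
  have hGs : ContDiffOn ℝ ∞ G Q := contDiffOn_chartImage hg (x, y, (0 : W))
  have hG' : ∀ b b' w, G (b, b', w) =
      g ((extChartAt I x).symm b, (extChartAt I' y).symm b', w) := fun b b' w => by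
    simp only [hG, hE]
    rfl
  have hQ' : ∀ b b' w, (b, b', w) ∈ Q ↔ (b ∈ (extChartAt I x).target ∧
      b' ∈ (extChartAt I' y).target) ∧
      ((extChartAt I x).symm b, (extChartAt I' y).symm b', w) ∈ U := fun b b' w => by
    rw [hQ, chartImage, hE]
    exact ⟨fun h => ⟨⟨h.1.1, h.1.2.1⟩, h.2⟩, fun h => ⟨⟨h.1.1, h.1.2, mem_univ w⟩, h.2⟩⟩
  set ψ : B → B' := fun b => extChartAt I' y (φ ((extChartAt I x).symm b)) with hψ
  have hψs : ContDiffOn ℝ k ψ S := ContMDiffMap.contDiffOn_writtenInExtChartAt φ.contMDiff x y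
  have hws : ∀ w : C^k⟮I, D; 𝓘(ℝ, W), W⟯,
      ContDiffOn ℝ k (fun b => w ((extChartAt I x).symm b)) S := fun w =>
    (contDiffOn_chart_expression w x).mono inter_subset_left
  -- In the charts, the operator is left composition of `b ↦ (b, ψ b, w b)`, affine in `w`, with `G`.
  set u : C^k⟮I, D; 𝓘(ℝ, W), W⟯ → B → B × B' × W :=
    fun w b => (b, ψ b, w ((extChartAt I x).symm b)) with hu
  set du : C^k⟮I, D; 𝓘(ℝ, W), W⟯ → B → B × B' × W :=
    fun w b => (0, 0, (w - w₀) ((extChartAt I x).symm b)) with hdu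
  have hus : ∀ w, ContDiffOn ℝ k (u w) S := fun w =>
    contDiffOn_id.prodMk (hψs.prodMk (hws w))
  have hψ' : ∀ b ∈ S, (extChartAt I' y).symm (ψ b) = φ ((extChartAt I x).symm b) := fun b hb =>
    (extChartAt I' y).left_inv hb.2
  have huQ : ∀ w ∈ superpositionDomain φ U, MapsTo (u w) S Q := fun w hw b hb => by
    rw [hu, hQ']
    refine ⟨⟨hb.1, (extChartAt I' y).map_source hb.2⟩, ?_⟩
    rw [hψ' b hb]
    exact hw _
  have hGu : ∀ w, ∀ b ∈ S, G (u w b) = g ((extChartAt I x).symm b,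
      φ ((extChartAt I x).symm b), w ((extChartAt I x).symm b)) := fun w b hb => by
    rw [hu, hG', hψ' b hb]
  have hev : ∀ᶠ w in 𝓝 w₀, w ∈ superpositionDomain φ U :=
    (isOpen_superpositionDomain φ hU).mem_nhds hw₀
  have hexp : HasCkExpansion k S K (𝓝 w₀) u (u w₀) du fun w => ‖w - w₀‖ := by
    refine ⟨hus w₀, Eventually.of_forall hus, Eventually.of_forall fun w =>
      contDiffOn_const.prodMk (contDiffOn_const.prodMk (hws _)), ?_, ?_⟩
    · have h1 : CkIsBigO k S K (𝓝 w₀) (fun w b => (w - w₀) ((extChartAt I x).symm b))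
          fun w => ‖w - w₀‖ := fun j hj => by
        refine IsBigO.of_bound 1 (eventually_prod_principal_iff.2 (Eventually.of_forall ?_))
        rintro w _ ⟨p, hp, rfl⟩
        rw [one_mul, norm_norm, iteratedFDerivWithin_chartImage _ x hop
          ((compactChartCover I D).piece_subset x hp.1)
          ((compactChartCover I' D').piece_subset y hp.2)]
        exact (w - w₀).norm_iteratedFDerivWithin_le_norm hx hp.1 hj
      have h2 := h1.clm_comp ((ContinuousLinearMap.inr ℝ B (B' × W)).comp
        (ContinuousLinearMap.inr ℝ B' W)) hSu hKS (Eventually.of_forall fun w => hws (w - w₀))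
      exact h2
    · have h0 : (fun w b => u w b - u w₀ b - du w b) = fun _ _ => (0 : B × B' × W) := by
        funext w b
        simp [hu, hdu]
      rw [h0]
      intro j hj
      simp only [iteratedFDerivWithin_fun_zero]
      exact isLittleO_zero _ _
  have hb : Tendsto (fun w => ‖w - w₀‖) (𝓝 w₀) (𝓝 0) := by
    have : Continuous fun w => ‖w - w₀‖ := by fun_prop
    simpa using this.tendsto w₀
  have hfin := (HasCkExpansion.comp.{w₁, w₂, w₃} hQc hGs hSu hKS hKc hexp hb (huQ w₀ hw₀)
    (hev.mono huQ)).isLittleO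
  refine hfin.congr hKS ?_
  filter_upwards [hev] with w hw b hb
  set p := (extChartAt I x).symm b with hp
  have hd : fderivWithin ℝ G Q (u w₀ b) (du w b) =
      fibreDeriv g (p, φ p, w₀ p) ((w - w₀) p) := by
    have d1 : HasFDerivAt (fun ζ : W => (b, ψ b, ζ))
        ((ContinuousLinearMap.inr ℝ B (B' × W)).comp (ContinuousLinearMap.inr ℝ B' W)) (w₀ p) := by
      have := (hasFDerivAt_const (𝕜 := ℝ) b (w₀ p)).prodMk
        ((hasFDerivAt_const (𝕜 := ℝ) (ψ b) (w₀ p)).prodMk (hasFDerivAt_id (𝕜 := ℝ) (w₀ p)))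
      exact this
    have d2 : HasFDerivWithinAt G (fderivWithin ℝ G Q (u w₀ b)) Q (b, ψ b, w₀ p) :=
      ((hGs.differentiableOn (by simp)) _ (huQ w₀ hw₀ hb)).hasFDerivWithinAt
    have d3 : ∀ᶠ ζ in 𝓝 (w₀ p), (b, ψ b, ζ) ∈ Q := by
      have hc : Continuous fun ζ : W => (p, φ p, ζ) := by fun_prop
      filter_upwards [(hU.preimage hc).mem_nhds (hw₀ p)] with ζ hζ
      rw [hQ']
      refine ⟨⟨hb.1, (extChartAt I' y).map_source hb.2⟩, ?_⟩
      rw [hψ' b hb]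
      exact hζ
    have d4 := d2.comp_hasFDerivAt (w₀ p) d1 d3
    have d5 := hasFDerivAt_fibre hU hg (hw₀ p)
    have d6 : G ∘ (fun ζ : W => (b, ψ b, ζ)) = fun ζ => g (p, φ p, ζ) := by
      funext ζ
      rw [Function.comp_apply, hG', hψ' b hb]
    rw [d6] at d4
    exact congrArg (fun A => A ((w - w₀) p)) (d4.unique d5)
  simp only [hd, hGu w b hb, hGu w₀ b hb]
  change _ = superposition φ hg w p - superposition φ hg w₀ p -
    superposition φ (hg.fibreDeriv hU) w₀ p ((w - w₀) p)
  rw [superposition_apply φ hg hw, superposition_apply φ hg hw₀, superposition_apply φ _ hw₀]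

theorem hasFDerivAt_superposition (φ : C^k⟮I, D; I', D'⟯) {g : D × D' × W → Y}
    {U : Set (D × D' × W)} (hU : IsOpen U)
    (hg : ContMDiffOn (I.prod (I'.prod 𝓘(ℝ, W))) 𝓘(ℝ, Y) ∞ g U)
    {w₀ : C^k⟮I, D; 𝓘(ℝ, W), W⟯} (hw₀ : w₀ ∈ superpositionDomain φ U) :
    HasFDerivAt (superposition φ hg) (superpositionDeriv φ hU hg w₀) w₀ := by
  refine HasFDerivAt.of_isLittleO (IsLittleO.of_bound fun ε hε => ?_)
  have h : ∀ x ∈ (compactChartCover I D).index, ∀ y ∈ (compactChartCover I' D').index,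
      ∀ j ∈ Finset.range (k + 1), ∀ᶠ w in 𝓝 w₀, ∀ p ∈ (compactChartCover I D).piece x,
      φ p ∈ (compactChartCover I' D').piece y →
      ‖iteratedFDerivWithin ℝ j (fun b => (superposition φ hg w - superposition φ hg w₀ -
        superpositionDeriv φ hU hg w₀ (w - w₀)) ((extChartAt I x).symm b))
        (chartImage I x (φ ⁻¹' (extChartAt I' y).source)) (extChartAt I x p)‖ ≤
        ε * ‖w - w₀‖ := fun x hx y hy j hj => by
    have h1 := (superposition_local_estimate φ hU hg hw₀ x hx y j
      (Nat.lt_succ_iff.1 (Finset.mem_range.1 hj))).bound hε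
    filter_upwards [eventually_prod_principal_iff.1 h1] with w hw p hp hpy
    have h2 := hw _ ⟨p, ⟨hp, hpy⟩, rfl⟩
    rwa [norm_norm] at h2
  simp only [← Filter.eventually_all_finset] at h
  filter_upwards [h] with w hw
  exact ContMDiffMap.norm_le_of_forall_refined (I' := I') φ.contMDiff.continuous _ (by positivity)
    fun x hx y hy j hj => hw x hx y hy j (Finset.mem_range.2 (Nat.lt_succ_of_le hj))

theorem contDiffOn_superposition_nat (φ : C^k⟮I, D; I', D'⟯) (n : ℕ) :
    ∀ {Y : Type w₃} [NormedAddCommGroup Y] [NormedSpace ℝ Y] {g : D × D' × W → Y}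
    {U : Set (D × D' × W)} (_ : IsOpen U)
    (hg : ContMDiffOn (I.prod (I'.prod 𝓘(ℝ, W))) 𝓘(ℝ, Y) ∞ g U),
    ContDiffOn ℝ n (superposition φ hg) (superpositionDomain φ U) := by
  induction n with
  | zero =>
    intro Y _ _ g U hU hg
    exact contDiffOn_zero.2 fun w hw =>
      (hasFDerivAt_superposition φ hU hg hw).continuousAt.continuousWithinAt
  | succ n ih =>
    intro Y _ _ g U hU hg
    have hop := isOpen_superpositionDomain φ hU
    push_cast
    rw [contDiffOn_succ_iff_fderiv_of_isOpen hop]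
    refine ⟨fun w hw => (hasFDerivAt_superposition φ hU hg hw).differentiableAt.differentiableWithinAt,
      by simp, ?_⟩
    refine ContDiffOn.congr (f := superpositionDeriv φ hU hg) ?_
      fun w hw => (hasFDerivAt_superposition φ hU hg hw).fderiv
    exact (ContMDiffMap.bilinCLM (ContinuousLinearMap.id ℝ (W →L[ℝ] Y))).contDiff.comp_contDiffOn
      (ih hU (hg.fibreDeriv hU))

/-- A superposition operator with smooth kernel is smooth between spaces of `C^k` maps. -/
theorem contDiffOn_superposition (φ : C^k⟮I, D; I', D'⟯) {g : D × D' × W → Y}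
    {U : Set (D × D' × W)} (hU : IsOpen U)
    (hg : ContMDiffOn (I.prod (I'.prod 𝓘(ℝ, W))) 𝓘(ℝ, Y) ∞ g U) :
    ContDiffOn ℝ ∞ (superposition φ hg) (superpositionDomain φ U) :=
  contDiffOn_infty.2 fun n => contDiffOn_superposition_nat φ n hU hg

end Superposition

/-! ### Right composition in the charts of the manifolds of maps -/

section RightComposition

variable {B H : Type*} [NormedAddCommGroup B] [NormedSpace ℝ B] [TopologicalSpace H]
  {I : ModelWithCorners ℝ B H} {D : Type*} [TopologicalSpace D] [ChartedSpace H D]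
  {B' H' : Type*} [NormedAddCommGroup B'] [NormedSpace ℝ B'] [TopologicalSpace H']
  {I' : ModelWithCorners ℝ B' H'} {D' : Type*} [TopologicalSpace D'] [ChartedSpace H' D']
  {BX HX : Type*} [NormedAddCommGroup BX] [NormedSpace ℝ BX] [TopologicalSpace HX]
  {IX : ModelWithCorners ℝ BX HX} {X : Type*} [TopologicalSpace X] [ChartedSpace HX X] {k : ℕ}

namespace BundleNbhd

theorem chart_apply (c : BundleNbhd I D IX X) {f : C^k⟮I, D; IX, X⟯} (hf : f ∈ c.chartSource k)
    (p : D) : (c.chart f).1 p = c.toFun (p, f p) := by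
  rw [chart, dif_pos hf]
  rfl

/-- The pointwise projection of `C^k` maps to the fibre onto `C^k` sections, a continuous left
inverse of the inclusion of the space of sections. -/
noncomputable def sectionProj [IsManifold I ∞ D] [CompactSpace D] [T2Space D]
    (c : BundleNbhd I D IX X) (k : ℕ) : C^k⟮I, D; 𝓘(ℝ, c.Fib), c.Fib⟯ →L[ℝ] c.sections k :=
  (ContMDiffMap.bilinCLM (ContinuousLinearMap.id ℝ (c.Fib →L[ℝ] c.Fib))
    ⟨c.proj, c.contMDiff_proj.of_le (by exact_mod_cast le_top)⟩).codRestrict (c.sections k)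
    fun v p => c.proj_proj p (v p)

theorem sectionProj_coe [IsManifold I ∞ D] [CompactSpace D] [T2Space D]
    (c : BundleNbhd I D IX X) (v : c.sections k) : c.sectionProj k v.1 = v := by
  ext p : 2
  exact v.2 p

variable (c₁ : BundleNbhd I' D' IX X) (c₂ : BundleNbhd I D IX X)

/-- The kernel `(p, q, w) ↦ Ψ₂ (p, Ψ₁⁻¹ (q, w))` through which right composition is expressed in the
charts given by `Ψ₁` and `Ψ₂`: the local expression of `f ↦ f ∘ φ` is the superposition
operator with this kernel at `q = φ p`, applied to `v ∘ φ`. -/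
def transition (z : D × D' × c₁.Fib) : c₂.Fib := c₂.toFun (z.1, c₁.invFun z.2)

/-- The open set on which the kernel `transition` is defined. -/
def transitionDomain : Set (D × D' × c₁.Fib) :=
  {z | z.2 ∈ c₁.target ∧ (z.1, c₁.invFun z.2) ∈ c₂.source}

theorem contMDiffOn_prod_invFun :
    ContMDiffOn (I.prod (I'.prod 𝓘(ℝ, c₁.Fib))) (I.prod IX) ∞
      (fun z : D × D' × c₁.Fib => (z.1, c₁.invFun z.2)) (Prod.snd ⁻¹' c₁.target) :=
  contMDiffOn_fst.prodMk (c₁.contMDiffOn_invFun.comp contMDiffOn_snd fun _ hz => hz)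

theorem isOpen_transitionDomain : IsOpen (transitionDomain c₁ c₂) :=
  (contMDiffOn_prod_invFun (I := I) c₁).continuousOn.isOpen_inter_preimage
    (c₁.isOpen_target.preimage continuous_snd) c₂.isOpen_source

theorem contMDiffOn_transition :
    ContMDiffOn (I.prod (I'.prod 𝓘(ℝ, c₁.Fib))) 𝓘(ℝ, c₂.Fib) ∞ (transition c₁ c₂)
      (transitionDomain c₁ c₂) :=
  c₂.contMDiffOn_toFun.comp ((contMDiffOn_prod_invFun c₁).mono fun _ hz => hz.1) fun _ hz => hz.2

variable {c₁ c₂}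

theorem mdifferentiableAt_fibre {p : D} {x : X} (h₂ : (p, x) ∈ c₂.source) :
    MDifferentiableAt IX 𝓘(ℝ, c₂.Fib) (fun x => c₂.toFun (p, x)) x := by
  have h : ContMDiffAt (I.prod IX) 𝓘(ℝ, c₂.Fib) ∞ c₂.toFun (p, x) :=
    (c₂.contMDiffOn_toFun _ h₂).contMDiffAt (c₂.isOpen_source.mem_nhds h₂)
  exact (h.comp x (contMDiffAt_const.prodMk contMDiffAt_id)).mdifferentiableAt (by simp)

theorem mem_transitionDomain {p : D} {q : D'} {x : X} (h₁ : (q, x) ∈ c₁.source)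
    (h₂ : (p, x) ∈ c₂.source) : (p, q, c₁.toFun (q, x)) ∈ transitionDomain c₁ c₂ := by
  refine ⟨c₁.map_source q x h₁, ?_⟩
  change (p, c₁.invFun (q, c₁.toFun (q, x))) ∈ c₂.source
  rwa [c₁.left_inv q x h₁]

/-- The kernel `transition` intertwines the fibre derivatives of the two charts. -/
theorem fibreDeriv_transition {p : D} {q : D'} {x : X} (h₁ : (q, x) ∈ c₁.source)
    (h₂ : (p, x) ∈ c₂.source) (ξ : TangentSpace IX x) :
    fibreDeriv (transition c₁ c₂) (p, q, c₁.toFun (q, x))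
      (mfderiv IX 𝓘(ℝ, c₁.Fib) (fun x => c₁.toFun (q, x)) x ξ : c₁.Fib) =
      (mfderiv IX 𝓘(ℝ, c₂.Fib) (fun x => c₂.toFun (p, x)) x ξ : c₂.Fib) := by
  have hA := hasFDerivAt_fibre (isOpen_transitionDomain c₁ c₂) (contMDiffOn_transition c₁ c₂)
    (mem_transitionDomain h₁ h₂)
  have he : ((fun w => transition c₁ c₂ (p, q, w)) ∘ fun x => c₁.toFun (q, x)) =ᶠ[𝓝 x]
      fun x => c₂.toFun (p, x) := by
    have hc : ContinuousAt (fun y : X => (q, y)) x := by fun_prop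
    filter_upwards [hc (c₁.isOpen_source.mem_nhds h₁)] with y hy
    change c₂.toFun (p, c₁.invFun (q, c₁.toFun (q, y))) = _
    rw [c₁.left_inv q y hy]
  have hcomp := hA.hasMFDerivAt.comp x (mdifferentiableAt_fibre h₁).hasMFDerivAt
  rw [← he.mfderiv_eq, hcomp.mfderiv]
  rfl

end BundleNbhd

open BundleNbhd ContMDiffMap

variable [IsManifold I ∞ D] [CompactSpace D] [T2Space D]
  [IsManifold I' ∞ D'] [CompactSpace D'] [T2Space D'] (φ : D ≃ₘ^k⟮I, I'⟯ D')
  (c₁ : BundleNbhd I' D' IX X) (c₂ : BundleNbhd I D IX X)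

/-- The local expression of right composition with `φ`, as a map into the space of sections: the
superposition operator with kernel `transition`, preceded by `v ↦ v ∘ φ` and followed by the
projection to the sections. -/
noncomputable def rightCompExpr (v : c₁.sections k) : c₂.sections k :=
  c₂.sectionProj k (superposition (φ : C^k⟮I, D; I', D'⟯) (contMDiffOn_transition c₁ c₂)
    (pullbackCLM (φ : C^k⟮I, D; I', D'⟯) v.1))

/-- The sections `v` for which `v ∘ φ` takes its values in the domain of the kernel
`transition`. -/
def rightCompDomain : Set (c₁.sections k) :=
  {v | pullbackCLM (φ : C^k⟮I, D; I', D'⟯) v.1 ∈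
    superpositionDomain (φ : C^k⟮I, D; I', D'⟯) (transitionDomain c₁ c₂)}

theorem isOpen_rightCompDomain : IsOpen (rightCompDomain φ c₁ c₂) :=
  (isOpen_superpositionDomain _ (isOpen_transitionDomain c₁ c₂)).preimage
    ((pullbackCLM (φ : C^k⟮I, D; I', D'⟯)).continuous.comp continuous_subtype_val)

variable {φ c₁ c₂}

theorem mem_chartTarget_of_mem_rightCompDomain {v : c₁.sections k}
    (hv : v ∈ rightCompDomain φ c₁ c₂) : v ∈ c₁.chartTarget k := fun q => by
  -- `φ` is surjective, so `v ∘ φ` controls all values of `v`.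
  have h := (hv (φ.symm q)).1
  change (φ (φ.symm q), v.1 (φ (φ.symm q))) ∈ c₁.target at h
  rwa [φ.apply_symm_apply] at h

theorem rightComp_chartInv_mem {v : c₁.sections k} (hv : v ∈ rightCompDomain φ c₁ c₂) :
    rightComp φ (c₁.chartInv v (mem_chartTarget_of_mem_rightCompDomain hv)) ∈ c₂.chartSource k :=
  fun p => (hv p).2

theorem chart_mem_rightCompDomain {f : C^k⟮I', D'; IX, X⟯} (hf : f ∈ c₁.chartSource k)
    (hf' : rightComp φ f ∈ c₂.chartSource k) : c₁.chart f ∈ rightCompDomain φ c₁ c₂ := fun p => by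
  have h := mem_transitionDomain (hf (φ p)) (hf' p)
  change (p, φ p, (c₁.chart f).1 (φ p)) ∈ _
  rwa [c₁.chart_apply hf]

theorem localExpr_rightComp {v : c₁.sections k} (hv : v ∈ rightCompDomain φ c₁ c₂) :
    localExpr (rightComp φ) c₁ c₂ v = rightCompExpr φ c₁ c₂ v := by
  rw [localExpr, dif_pos (mem_chartTarget_of_mem_rightCompDomain hv), rightCompExpr]
  refine (c₂.sectionProj_coe _).symm.trans (congrArg _ ?_)
  ext p
  rw [c₂.chart_apply (rightComp_chartInv_mem hv), superposition_apply _ _ hv]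
  rfl

theorem localExpr_rightComp_eventuallyEq {f : C^k⟮I', D'; IX, X⟯} (hf : f ∈ c₁.chartSource k)
    (hf' : rightComp φ f ∈ c₂.chartSource k) :
    localExpr (rightComp φ) c₁ c₂ =ᶠ[𝓝 (c₁.chart f)] rightCompExpr φ c₁ c₂ :=
  mem_of_superset ((isOpen_rightCompDomain φ c₁ c₂).mem_nhds (chart_mem_rightCompDomain hf hf'))
    fun _ => localExpr_rightComp

theorem hasFDerivAt_localExpr_rightComp {f : C^k⟮I', D'; IX, X⟯} (hf : f ∈ c₁.chartSource k)
    (hf' : rightComp φ f ∈ c₂.chartSource k) :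
    HasFDerivAt (localExpr (rightComp φ) c₁ c₂)
      ((c₂.sectionProj k).comp ((superpositionDeriv (φ : C^k⟮I, D; I', D'⟯)
        (isOpen_transitionDomain c₁ c₂) (contMDiffOn_transition c₁ c₂)
        (pullbackCLM (φ : C^k⟮I, D; I', D'⟯) (c₁.chart f).1)).comp
        ((pullbackCLM (φ : C^k⟮I, D; I', D'⟯)).comp (c₁.sections k).subtypeL))) (c₁.chart f) := by
  refine HasFDerivAt.congr_of_eventuallyEq ?_ (localExpr_rightComp_eventuallyEq hf hf')
  exact (c₂.sectionProj k).hasFDerivAt.comp _ ((hasFDerivAt_superposition _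
    (isOpen_transitionDomain c₁ c₂) (contMDiffOn_transition c₁ c₂)
    (chart_mem_rightCompDomain hf hf')).comp (c₁.chart f)
      (f := (pullbackCLM (φ : C^k⟮I, D; I', D'⟯)).comp (c₁.sections k).subtypeL)
      ((pullbackCLM (φ : C^k⟮I, D; I', D'⟯)).comp (c₁.sections k).subtypeL).hasFDerivAt)

variable (φ)

/-- Right composition with `φ` is a smooth map between the manifolds of `C^k` maps. -/
theorem isSmoothBetween_rightComp :
    IsSmoothBetween (fun f : C^k⟮I', D'; IX, X⟯ => rightComp φ f) := by
  intro f c₁ c₂ hf hf'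
  have hmem := (isOpen_rightCompDomain φ c₁ c₂).mem_nhds (chart_mem_rightCompDomain hf hf')
  refine ⟨mem_of_superset hmem fun v hv => ⟨mem_chartTarget_of_mem_rightCompDomain hv,
    rightComp_chartInv_mem hv⟩, ?_⟩
  refine ContDiffAt.congr_of_eventuallyEq ?_ (localExpr_rightComp_eventuallyEq hf hf')
  have h1 := (contDiffOn_superposition (φ : C^k⟮I, D; I', D'⟯) (isOpen_transitionDomain c₁ c₂)
    (contMDiffOn_transition c₁ c₂)).contDiffAt ((isOpen_superpositionDomain _
      (isOpen_transitionDomain c₁ c₂)).mem_nhds (chart_mem_rightCompDomain hf hf'))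
  exact (c₂.sectionProj k).contDiff.contDiffAt.comp _ (h1.comp (c₁.chart f)
    (f := (pullbackCLM (φ : C^k⟮I, D; I', D'⟯)).comp (c₁.sections k).subtypeL)
    ((pullbackCLM (φ : C^k⟮I, D; I', D'⟯)).comp (c₁.sections k).subtypeL).contDiff.contDiffAt)

/-- The tangent map of right composition with `φ` is right composition with `φ`. -/
theorem isTangentMap_rightComp [IsManifold IX ∞ X] :
    IsTangentMap (fun f : C^k⟮I', D'; IX, X⟯ => rightComp φ f)
      (fun η : C^k⟮I', D'; IX.tangent, TangentBundle IX X⟯ => rightComp φ η) := by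
  refine fun η => ⟨rfl, fun c₁ c₂ h₁ h₂ => ?_⟩
  have hf : projMap η ∈ c₁.chartSource k := h₁
  have hf' : rightComp φ (projMap η) ∈ c₂.chartSource k := h₂
  have hd := hasFDerivAt_localExpr_rightComp hf hf'
  change fderiv ℝ (localExpr (rightComp φ) c₁ c₂) _ _ = _
  rw [hd.fderiv]
  ext p : 2
  have hw : pullbackCLM (φ : C^k⟮I, D; I', D'⟯) (c₁.chart (projMap η)).1 ∈
      superpositionDomain _ (transitionDomain c₁ c₂) :=
    chart_mem_rightCompDomain hf hf'
  change c₂.proj p (superposition (φ : C^k⟮I, D; I', D'⟯)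
    ((contMDiffOn_transition c₁ c₂).fibreDeriv (isOpen_transitionDomain c₁ c₂))
    (pullbackCLM (φ : C^k⟮I, D; I', D'⟯) (c₁.chart (projMap η)).1) p
    ((c₁.chartDerivOn η h₁).1 (φ p))) = _
  rw [superposition_apply _ _ hw]
  change c₂.proj p (fibreDeriv (transition c₁ c₂) (p, φ p, (c₁.chart (projMap η)).1 (φ p))
    (mfderiv IX 𝓘(ℝ, c₁.Fib) (fun x => c₁.toFun (φ p, x)) (η (φ p)).proj (η (φ p)).snd : c₁.Fib)) =
    (mfderiv IX 𝓘(ℝ, c₂.Fib) (fun x => c₂.toFun (p, x)) (η (φ p)).proj (η (φ p)).snd : c₂.Fib)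
  rw [c₁.chart_apply hf]
  refine (congrArg (c₂.proj p) (fibreDeriv_transition (h₁ (φ p)) (h₂ p) _)).trans ?_
  exact c₂.proj_fibreDeriv p _ (h₂ p) _

end RightComposition

theorem proposition2p5
    {B H : Type*} [NormedAddCommGroup B] [NormedSpace ℝ B] [FiniteDimensional ℝ B]
    [TopologicalSpace H] (I : ModelWithCorners ℝ B H)
    (D : Type*) [TopologicalSpace D] [ChartedSpace H D] [IsManifold I ∞ D]
    [CompactSpace D] [T2Space D]
    {B' H' : Type*} [NormedAddCommGroup B'] [NormedSpace ℝ B'] [FiniteDimensional ℝ B']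
    [TopologicalSpace H'] (I' : ModelWithCorners ℝ B' H')
    (D' : Type*) [TopologicalSpace D'] [ChartedSpace H' D'] [IsManifold I' ∞ D']
    [CompactSpace D'] [T2Space D']
    {BM HM : Type*} [NormedAddCommGroup BM] [NormedSpace ℝ BM] [FiniteDimensional ℝ BM]
    [TopologicalSpace HM] (IM : ModelWithCorners ℝ BM HM) [IM.Boundaryless]
    (M : Type*) [TopologicalSpace M] [ChartedSpace HM M] [IsManifold IM ∞ M]
    [T2Space M] [SecondCountableTopology M]
    (F : Type*) [NormedAddCommGroup F] [NormedSpace ℝ F] [FiniteDimensional ℝ F]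
    (V : M → Type*) [TopologicalSpace (TotalSpace F V)] [∀ x, AddCommGroup (V x)]
    [∀ x, Module ℝ (V x)] [∀ x, TopologicalSpace (V x)]
    [∀ x, IsTopologicalAddGroup (V x)] [∀ x, ContinuousSMul ℝ (V x)]
    [FiberBundle F V] [VectorBundle ℝ F V] [ContMDiffVectorBundle ∞ F V IM]
    (P : BundleConnection IM F V) (k : ℕ) (hk : 2 ≤ k) (φ : D ≃ₘ^k⟮I, I'⟯ D') :
    IsAffineMap (P.natural I' D' k) (P.natural I D k)
      (fun e : C^k⟮I', D'; IM.prod 𝓘(ℝ, F), TotalSpace F V⟯ => rightComp φ e)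
      (fun f : C^k⟮I', D'; IM, M⟯ => rightComp φ f) := by
  exact
    { smooth_base := isSmoothBetween_rightComp φ
      smooth_total := isSmoothBetween_rightComp φ
      covers := fun _ => rfl
      linear := by
        rintro a b e₁ e₂ e₃ ⟨f, u, v, h₁, h₂, h₃⟩
        exact ⟨fun p => f (φ p), fun p => u (φ p), fun p => v (φ p), fun p => h₁ (φ p),
          fun p => h₂ (φ p), fun p => h₃ (φ p)⟩
      comm := ⟨fun η => rightComp φ η, isTangentMap_rightComp φ, fun _ => rfl⟩ }
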